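/- **Setting.** All maps are $C^\infty$ germs. Let $f:(\mathbb R^2,0)\to(\mathbb R^3,0)$, $(s,t)\mapsto f(s,t)$, be in Fukui's normal form: $\gamma(s)=f(s,0)$ is parametrized by arc length and its curvature $\kappa$ satisfies $\kappa(0)\neq0$; the singular set of $f$ is $\{t=0\}$; the vectors $\boldsymbol f_k(s)=\partial_t^kf(s,0)$ satisfy $\langle \boldsymbol f_k(s),\gamma'(s)\rangle=0$ for all $k\ge1$; and $\langle f_t,f_t\rangle=t^2$. Let $\boldsymbol t,\boldsymbol n,\boldsymbol b$ be the Frenet frame of $\gamma$ (with $\boldsymbol n'=-\kappa\boldsymbol t+\tau\boldsymbol b$), equal to the standard basis of $\mathbb R^3$ at $s=0$. Let $\theta(s)$ be a smooth function with $\boldsymbol f_2=\cos\theta\,\boldsymbol n-\sin\theta\,\boldsymbol b$ and put $b_k(s)=\langle \boldsymbol f_k(s),\sin\theta\,\boldsymbol n+\cos\theta\,\boldsymbol b\rangle$. Write $\kappa_0=\kappa(0)$, $\tau_0=\tau(0)$, $\theta_0=\theta(0)$, $\theta_1=\theta'(0)$, $b_{ik}=b_k^{(i)}(0)$, and $$C_2(e)=e^2(\tau_0-\theta_1)^2-\Bigl(\tfrac{b_{04}}3e-1\Bigr)\bigl(e\,\kappa_0\sin\theta_0-1\bigr).$$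 Assume that $f$ has a cuspidal cross cap at the origin, i.e. that up to germs of diffeomorphisms of source and target it is $(u,v)\mapsto(u,v^2,v^3(u\pm v^2))$. For $\boldsymbol p=(p,q,r)\in\mathbb R^3$ and $\varepsilon\in\mathbb R$ let $\Phi(s,t)=\|\boldsymbol p-f(s,t)\|^2-\varepsilon^2$ (the distance squared unfolding at $(\boldsymbol p,\varepsilon)$). Function germs $g,h$ at $0\in\mathbb R^2$ are $\mathcal R$-equivalent if $g=h\circ\varphi$ near $0$ for a germ of a diffeomorphism $\varphi$ fixing $0$. Say that $g$ is of type $A_k^{t}$ if it is $\mathcal R$-equivalent to $s^2+t^{k+1}$ or to $s^2-t^{k+1}$ and, when $k\ge2$, the kernel of its Hessian at $0$ is spanned by $\partial_t$. **Proposition.** Call (K) the condition that $p=0$ and $\varepsilon^2=p^2+q^2+r^2$. 1. $\Phi$ or $-\Phi$ is of type $A_1^t$ if and only if (K) holds, $q\neq\frac1{\kappa_0}$ and $-q\cos\theta_0+r\sin\theta_0\neq0$. Moreover $\Phi$ itself is of type $A_1^t$ if and only if in addition $q<\frac1{\kappa_0}$ or $-q\cos\theta_0+r\sin\theta_0>0$.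 If $\cos\theta_0\ne0$, then: 2. $\Phi$ or $-\Phi$ is of type $A_3^t$ if and only if (K) holds, $q\neq\frac1{\kappa_0}$, $-q\cos\theta_0+r\sin\theta_0=0$ and $C_2\bigl(\frac r{\cos\theta_0}\bigr)\neq0$. 3. $\Phi$ or $-\Phi$ is of type $A_4^t$ if and only if (K) holds, $q\neq\frac1{\kappa_0}$, $-q\cos\theta_0+r\sin\theta_0=0$, $C_2\bigl(\frac r{\cos\theta_0}\bigr)=0$ and $$\Bigl\{b_{13}(\tau_0-\theta_1)-\tfrac{b_{05}}{10}\kappa_0\sin\theta_0\Bigr\}\frac r{\cos\theta_0}+\tfrac{b_{05}}{10}\neq0.$$ Moreover, in 2 and 3, $\Phi$ itself is of that type if and only if in addition $q<\frac1{\kappa_0}$. -/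

import Mathlib

open scoped ContDiff Topology

noncomputable section

namespace CuspidalCrossCap

/-- Euclidean three-space. -/
abbrev E3 := EuclideanSpace ℝ (Fin 3)

/-! ### Germs, right equivalence, right-left equivalence -/

section Germs

variable {E F : Type*} [NormedAddCommGroup E] [NormedSpace ℝ E]
  [NormedAddCommGroup F] [NormedSpace ℝ F]

/-- `f` represents a smooth (`C^∞`) germ at `x`: it is smooth at every point near `x`. -/
def IsSmoothGermAt (f : E → F) (x : E) : Prop :=
  ∀ᶠ z in 𝓝 x, ContDiffAt ℝ ∞ f z

/-- `φ` represents a germ of a diffeomorphism `(E, 0) → (E, 0)`: a smooth germ fixing the origin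
which has a two-sided inverse smooth germ. -/
def IsDiffeoGerm (φ : E → E) : Prop :=
  IsSmoothGermAt φ 0 ∧ φ 0 = 0 ∧
    ∃ ψ : E → E, IsSmoothGermAt ψ 0 ∧ ψ 0 = 0 ∧
      (∀ᶠ z in 𝓝 (0 : E), ψ (φ z) = z) ∧ (∀ᶠ z in 𝓝 (0 : E), φ (ψ z) = z)

/-- Right equivalence of function germs at the origin: `g = h ∘ φ` near `0` for a germ of a
diffeomorphism `φ` of the source. -/
def RightEquiv (g h : E → ℝ) : Prop :=
  ∃ φ : E → E, IsDiffeoGerm φ ∧ ∀ᶠ z in 𝓝 (0 : E), g z = h (φ z)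

/-- Right-left equivalence of map germs `(E, 0) → (F, 0)`: `f = ψ ∘ g ∘ φ` near `0` for germs of
diffeomorphisms `φ` of the source and `ψ` of the target. -/
def RightLeftEquiv (f g : E → F) : Prop :=
  ∃ (φ : E → E) (ψ : F → F), IsDiffeoGerm φ ∧ IsDiffeoGerm ψ ∧
    ∀ᶠ z in 𝓝 (0 : E), f z = ψ (g (φ z))

end Germs

/-- The model `(u, v) ↦ (u, v², v³ (u + σ v²))`, with `σ = 1` or `σ = -1`. -/
def crossCapModel (σ : ℝ) (z : ℝ × ℝ) : E3 :=
  !₂[z.1, z.2 ^ 2, z.2 ^ 3 * (z.1 + σ * z.2 ^ 2)]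

/-- `f` has a cuspidal cross cap at the origin. -/
def HasCuspidalCrossCap (f : ℝ × ℝ → E3) : Prop :=
  RightLeftEquiv f (crossCapModel 1) ∨ RightLeftEquiv f (crossCapModel (-1))

/-! ### The singular curve, its Frenet apparatus and the transversal Taylor coefficients -/

/-- The curve `γ(s) = f(s, 0)`. -/
def gam (f : ℝ × ℝ → E3) (s : ℝ) : E3 := f (s, 0)

/-- The tangent vector `γ'`. -/
def tangentVec (f : ℝ × ℝ → E3) (s : ℝ) : E3 := deriv (gam f) s

/-- The curvature of `γ` (for unit speed `γ`). -/
def curvature (f : ℝ × ℝ → E3) (s : ℝ) : ℝ := ‖deriv (tangentVec f) s‖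

/-- The principal normal of `γ`. -/
def normalVec (f : ℝ × ℝ → E3) (s : ℝ) : E3 := (curvature f s)⁻¹ • deriv (tangentVec f) s

/-- The cross product of Euclidean three-space. -/
def cross (v w : E3) : E3 := WithLp.toLp 2 (crossProduct (WithLp.ofLp v) (WithLp.ofLp w))

/-- The binormal of `γ`. -/
def binormalVec (f : ℝ × ℝ → E3) (s : ℝ) : E3 := cross (tangentVec f s) (normalVec f s)

/-- The torsion of `γ`, with the sign convention `n' = -κ t + τ b`. -/
def torsion (f : ℝ × ℝ → E3) (s : ℝ) : ℝ := inner ℝ (deriv (normalVec f) s) (binormalVec f s)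

/-- The vector `f_k(s) = ∂_t^k f(s, 0)`, so that `f(s, t) = γ(s) + ∑_{k ≤ m} f_k(s) t^k / k! + …`. -/
def transCoeff (f : ℝ × ℝ → E3) (k : ℕ) (s : ℝ) : E3 := iteratedDeriv k (fun t => f (s, t)) 0

/-- The frame vector `cos θ n - sin θ b`. -/
def frame2 (f : ℝ × ℝ → E3) (θ : ℝ → ℝ) (s : ℝ) : E3 :=
  Real.cos (θ s) • normalVec f s - Real.sin (θ s) • binormalVec f s

/-- The frame vector `sin θ n + cos θ b`. -/
def frame3 (f : ℝ × ℝ → E3) (θ : ℝ → ℝ) (s : ℝ) : E3 :=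
  Real.sin (θ s) • normalVec f s + Real.cos (θ s) • binormalVec f s

/-- The functions `b_k(s) = ⟨f_k(s), sin θ n + cos θ b⟩`. -/
def bFun (f : ℝ × ℝ → E3) (θ : ℝ → ℝ) (k : ℕ) (s : ℝ) : ℝ :=
  inner ℝ (transCoeff f k s) (frame3 f θ s)

/-- The Taylor coefficients `b_{ik}`, i.e. the `i`-th derivative of `b_k` at `0`. -/
def bCoeff (f : ℝ × ℝ → E3) (θ : ℝ → ℝ) (i k : ℕ) : ℝ := iteratedDeriv i (bFun f θ k) 0

/-- The map germ `f : (ℝ², 0) → (ℝ³, 0)` is parametrized in Fukui's normal form, with angle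
function `θ`, in Euclidean coordinates adapted to the Frenet frame of `γ` at the origin. -/
structure IsFukuiNormalForm (f : ℝ × ℝ → E3) (θ : ℝ → ℝ) : Prop where
  smooth : IsSmoothGermAt f 0
  map_zero : f 0 = 0
  /-- `s` is an arc length parameter of `γ`. -/
  arc_length : ∀ᶠ s in 𝓝 (0 : ℝ), ‖tangentVec f s‖ = 1
  curvature_ne_zero : curvature f 0 ≠ 0
  /-- The singular set of `f` is `{t = 0}`. -/
  singular_set : ∀ᶠ z in 𝓝 (0 : ℝ × ℝ), (¬ Function.Injective (fderiv ℝ f z)) ↔ z.2 = 0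
  /-- `f_k` is orthogonal to `γ'` for `k = 1, 2, …`. -/
  orthogonal : ∀ k : ℕ, 1 ≤ k →
    ∀ᶠ s in 𝓝 (0 : ℝ), inner ℝ (transCoeff f k s) (tangentVec f s) = 0
  /-- `⟨f_t, f_t⟩ = t²`. -/
  half_arc_length : ∀ᶠ z in 𝓝 (0 : ℝ × ℝ),
    inner ℝ (deriv (fun t => f (z.1, t)) z.2) (deriv (fun t => f (z.1, t)) z.2) = z.2 ^ 2
  angle_smooth : IsSmoothGermAt θ 0
  /-- `θ` is the angle for which `f_2 = cos θ n - sin θ b`. -/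
  angle : ∀ᶠ s in 𝓝 (0 : ℝ), transCoeff f 2 s = frame2 f θ s
  /-- At the origin the Frenet frame is the standard basis. -/
  tangent_zero : tangentVec f 0 = !₂[1, 0, 0]
  normal_zero : normalVec f 0 = !₂[0, 1, 0]
  binormal_zero : binormalVec f 0 = !₂[0, 0, 1]

/-! ### The distance squared unfolding and its singularities -/

/-- The distance squared unfolding `Φ(s, t, 𝐩, ε) = ‖𝐩 - f(s, t)‖² - ε²`. -/
def distSqUnfolding (f : ℝ × ℝ → E3) (z : ℝ × ℝ) (P : E3) (ε : ℝ) : ℝ :=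
  ‖P - f z‖ ^ 2 - ε ^ 2

/-- The kernel of the Hessian of `g` at the origin. -/
def hessianKernel (g : ℝ × ℝ → ℝ) : Submodule ℝ (ℝ × ℝ) :=
  LinearMap.ker (fderiv ℝ (fderiv ℝ g) 0).toLinearMap

/-- `g` has an `A_k^{t,±}` singularity at the origin: it is right equivalent to `s² + t^{k+1}` or
to `s² - t^{k+1}` and, when the singularity is degenerate (`k ≥ 2`), the kernel of the Hessian is
the `t`-direction. -/
def HasAt (k : ℕ) (g : ℝ × ℝ → ℝ) : Prop :=
  (RightEquiv g (fun z => z.1 ^ 2 + z.2 ^ (k + 1)) ∨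
    RightEquiv g (fun z => z.1 ^ 2 - z.2 ^ (k + 1))) ∧
  (2 ≤ k → hessianKernel g = Submodule.span ℝ {((0 : ℝ), (1 : ℝ))})

/-- The quadratic polynomial
`C₂(e) = e² (τ₀ - θ₁)² - (b₀₄ e / 3 - 1) (e κ₀ sin θ₀ - 1)`. -/
def C2 (f : ℝ × ℝ → E3) (θ : ℝ → ℝ) (e : ℝ) : ℝ :=
  e ^ 2 * (torsion f 0 - deriv θ 0) ^ 2
    - (bCoeff f θ 0 4 / 3 * e - 1) * (e * curvature f 0 * Real.sin (θ 0) - 1)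

end CuspidalCrossCap

end

noncomputable section

namespace CuspidalCrossCap

open Asymptotics

/-! ### Smooth division and smooth germs -/

section Division

open MeasureTheory

variable {E : Type*} [NormedAddCommGroup E] [NormedSpace ℝ E]

/-! The type of `Φ` is read off from a finite jet. Give `s` weight 2 and `t` weight 1. The normal
form makes `f₁` vanish along the singular curve, and the cuspidal cross cap hypothesis makes `f₃(0)`
vanish. Hence `Φ` has no terms `t`, `st`, `t³`, `s²t`, and up to weight five it is `G₀ + G₁s + As² +
Tt² + Bst² + Ct⁴ + Est³ + Ft⁵` (`hasWeightedJet_distSq`, `IsFukuiNormalForm.hasWeightedJet`).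

Sufficiency comes from the splitting lemma. If `G₀ = G₁ = 0` and `A ≠ 0`, solving `∂ₛg = 0` gives a
curve `s = σ(t) = -(B/2A)t² + O(t³)`, and `g` is a square `(s - σ)²` times a unit plus a function of
`t` alone with coefficients `T`, `C - B²/4A`, `F - EB/2A` at `t²`, `t⁴`, `t⁵`
(`HasWeightedJet.exists_split`). The first nonzero one decides the type, and roots of the units give
the coordinate change (`rightEquiv_of_split`).

Necessity needs an invariant of right equivalence. The inequality `c‖z‖ᵏ ≤ ‖dg(z)‖` near `0` is one
(`GradientBound.of_rightEquiv`). It holds for `s² ± t^(k+1)` with exponent `k` and with no smaller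
exponent, and in split form it fails along `s = σ(t)` when the relevant coefficients vanish. The
sign in front of `s²` is detected by a positive direction of the Hessian
(`HasDiagonalJet.pos_of_rightEquiv`).

The vanishing of `f₃(0)` is geometric (`transCoeff_three_eq_zero`). A target function with nonzero
differential at `0` pulls back under `f` to order four. Its differential kills `γ'(0)`, `f₂(0)` and
`f₃(0)`. The last vector is orthogonal to the first two, so if it were nonzero the three would span
and the differential would be zero.

When `p = 0` and `T = 0`, the centre is `e (sin θ n + cos θ b)` at the origin, with `e = r / cos
θ₀`. Substitution turns `B² - 4AC` into `C₂(e)` and `2AF - EB` into `-e/3` times the expression of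
part 3. The factor `e` is harmless because `C₂(0) = -1`. -/

theorem contDiff_integral_unitInterval {F : (ℝ × ℝ) → ℝ → E} [FiniteDimensional ℝ E]
    (hF : ContDiff ℝ ∞ (fun x : (ℝ × ℝ) × ℝ => F x.1 x.2)) :
    ContDiff ℝ ∞ (fun p => ∫ u in (0 : ℝ)..1, F p u) := by
  -- The integral is a convolution evaluated at `0`: the indicator of `(0, 1]` against `y ↦ b(y)
  -- F(p, -y)`. The cutoff `b` is `1` on `[-2, 2]`, which contains `-u` for every `u` in the range
  -- of integration, and it supplies the compact support required for smoothness of convolutions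
  -- with parameters.
  let b : ContDiffBump (0 : ℝ) := ⟨2, 3, by norm_num, by norm_num⟩
  let φ : ℝ → ℝ := Set.indicator (Set.Ioc 0 1) (fun _ => 1)
  let g : ℝ × ℝ → ℝ → E := fun p y => b y • F p (-y)
  have hφ : LocallyIntegrable φ volume := by
    refine Integrable.locallyIntegrable ?_
    rw [integrable_indicator_iff measurableSet_Ioc]
    simp
  have hg : ContDiffOn ℝ ∞ (↿g) (Set.univ ×ˢ Set.univ) := by
    apply ContDiff.contDiffOn
    have h1 : ContDiff ℝ ∞ (fun x : (ℝ × ℝ) × ℝ => b x.2) := b.contDiff.comp contDiff_snd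
    have h2 : ContDiff ℝ ∞ (fun x : (ℝ × ℝ) × ℝ => F x.1 (-x.2)) :=
      hF.comp (contDiff_fst.prodMk contDiff_snd.neg)
    exact h1.smul h2
  have key := contDiffOn_convolution_right_with_param (n := ⊤) (μ := volume)
    (ContinuousLinearMap.lsmul ℝ ℝ : ℝ →L[ℝ] E →L[ℝ] E) (f := φ) (g := g) isOpen_univ
    (isCompact_closedBall (0 : ℝ) 3)
    (by
      intro p x _ hx
      have : b x = 0 := by
        apply b.zero_of_le_dist
        simp only [Metric.mem_closedBall, not_le] at hx
        exact hx.le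
      simp [g, this]) hφ hg
  rw [Set.univ_prod_univ, contDiffOn_univ] at key
  have h3 := key.comp (contDiff_id.prodMk (contDiff_const (c := (0 : ℝ))))
  convert h3 using 1
  funext p
  simp only [Function.comp, id, convolution_def, ContinuousLinearMap.lsmul_apply]
  rw [intervalIntegral.integral_of_le zero_le_one, ← integral_indicator measurableSet_Ioc]
  congr 1
  funext u
  by_cases hu : u ∈ Set.Ioc (0 : ℝ) 1
  · have : b (0 - u) = 1 := by
      apply b.one_of_mem_closedBall
      simp only [b, Metric.mem_closedBall, dist_zero_right, zero_sub, norm_neg, Real.norm_eq_abs]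
      rw [abs_of_pos hu.1]; linarith [hu.2]
    simp [φ, g, hu] at this ⊢
    rw [this, one_smul]
  · simp [φ, hu]

/-- Smooth division in the first variable. -/
theorem exists_eq_add_fst_smul [FiniteDimensional ℝ E] {F : ℝ × ℝ → E} (hF : ContDiff ℝ ∞ F) :
    ∃ R : ℝ × ℝ → E, ContDiff ℝ ∞ R ∧ ∀ z, F z = F (0, z.2) + z.1 • R z := by
  let D : ℝ × ℝ → E := fun z => fderiv ℝ F z (1, 0)
  have hD : ContDiff ℝ ∞ D := (hF.fderiv_right (m := ∞) (by simp)).clm_apply contDiff_const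
  refine ⟨fun z => ∫ u in (0 : ℝ)..1, D (u * z.1, z.2),
    contDiff_integral_unitInterval (F := fun z u => D (u * z.1, z.2)) ?_, fun z => ?_⟩
  · exact hD.comp ((contDiff_snd.mul (contDiff_fst.comp contDiff_fst)).prodMk
      (contDiff_snd.comp contDiff_fst))
  · have hd : ∀ u ∈ Set.uIcc (0 : ℝ) 1,
        HasDerivAt (fun u : ℝ => F (u * z.1, z.2)) (z.1 • D (u * z.1, z.2)) u := by
      intro u _
      have h1 : HasDerivAt (fun u : ℝ => (u * z.1, z.2)) (z.1, 0) u := by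
        have := ((hasDerivAt_id u).mul_const z.1).prodMk (hasDerivAt_const u z.2)
        simpa using this
      have h2 := ((hF.differentiable (by simp)) (u * z.1, z.2)).hasFDerivAt.comp_hasDerivAt u h1
      have h3 : z.1 • D (u * z.1, z.2) = fderiv ℝ F (u * z.1, z.2) (z.1, 0) := by
        simp only [D]
        rw [← map_smul]; simp
      rw [h3]
      exact h2
    have hc : Continuous (fun u : ℝ => z.1 • D (u * z.1, z.2)) := by
      have := hD.continuous
      fun_prop
    have := intervalIntegral.integral_eq_sub_of_hasDerivAt hd (hc.intervalIntegrable 0 1)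
    rw [intervalIntegral.integral_smul] at this
    simp at this
    rw [this]; simp

/-- Smooth division in the second variable. -/
theorem exists_eq_add_snd_smul [FiniteDimensional ℝ E] {F : ℝ × ℝ → E} (hF : ContDiff ℝ ∞ F) :
    ∃ R : ℝ × ℝ → E, ContDiff ℝ ∞ R ∧ ∀ z, F z = F (z.1, 0) + z.2 • R z := by
  obtain ⟨R, hR, h⟩ := exists_eq_add_fst_smul (F := fun z => F z.swap)
    (hF.comp (contDiff_snd.prodMk contDiff_fst))
  exact ⟨fun z => R z.swap, hR.comp (contDiff_snd.prodMk contDiff_fst), fun z => h z.swap⟩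

/-- Smooth division for functions of one variable. -/
theorem exists_eq_add_smul [FiniteDimensional ℝ E] {F : ℝ → E} (hF : ContDiff ℝ ∞ F) :
    ∃ R : ℝ → E, ContDiff ℝ ∞ R ∧ ∀ t, F t = F 0 + t • R t := by
  obtain ⟨R, hR, h⟩ := exists_eq_add_fst_smul (F := fun z => F z.1) (hF.comp contDiff_fst)
  exact ⟨fun t => R (t, 0), hR.comp (contDiff_id.prodMk contDiff_const), fun t => h (t, 0)⟩

end Division

/-! ### Global representatives and diffeomorphism germs -/

section Germs

variable {E F : Type*} [NormedAddCommGroup E] [NormedSpace ℝ E]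
  [NormedAddCommGroup F] [NormedSpace ℝ F]

theorem IsSmoothGermAt.contDiffAt {f : E → F} {x : E} (hf : IsSmoothGermAt f x) :
    ContDiffAt ℝ ∞ f x := hf.self_of_nhds

theorem isSmoothGermAt_of_contDiff {f : E → F} (hf : ContDiff ℝ ∞ f) (x : E) :
    IsSmoothGermAt f x := Filter.Eventually.of_forall fun _ => hf.contDiffAt

/-- A smooth germ has a globally smooth representative. -/
theorem IsSmoothGermAt.exists_contDiff [FiniteDimensional ℝ E] {f : E → F} {x : E}
    (hf : IsSmoothGermAt f x) : ∃ g : E → F, ContDiff ℝ ∞ g ∧ f =ᶠ[𝓝 x] g := by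
  obtain ⟨s, hs, hso, hxs⟩ := eventually_nhds_iff.1 hf
  obtain ⟨r, hr, hrs⟩ := Metric.isOpen_iff.1 hso x hxs
  have hr2 : 0 < r / 2 := by positivity
  let b : ContDiffBump x := ⟨r / 4, r / 2, by positivity, by linarith⟩
  refine ⟨fun z => b z • f z, ?_, ?_⟩
  · rw [contDiff_iff_contDiffAt]
    intro z
    by_cases hz : z ∈ s
    · exact b.contDiff.contDiffAt.smul (hs z hz)
    · have : z ∉ tsupport b := by
        rw [b.tsupport_eq]
        intro hz'
        exact hz (hrs (lt_of_le_of_lt (Metric.mem_closedBall.1 hz') (by simp [b]; linarith)))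
      have h0 : (fun z => b z • f z) =ᶠ[𝓝 z] fun _ => 0 := by
        filter_upwards [notMem_tsupport_iff_eventuallyEq.1 this] with y hy
        simp [hy]
      exact contDiffAt_const.congr_of_eventuallyEq h0
  · filter_upwards [b.eventuallyEq_one] with y hy
    simp [hy]

/-- The inverse function theorem for smooth germs. -/
theorem isDiffeoGerm_of_hasFDerivAt [CompleteSpace E] {φ : E → E} (hφ : IsSmoothGermAt φ 0)
    (h0 : φ 0 = 0) (φ' : E ≃L[ℝ] E) (hd : HasFDerivAt φ (φ' : E →L[ℝ] E) 0) :
    IsDiffeoGerm φ := by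
  have hn : (∞ : WithTop ℕ∞) ≠ 0 := by simp
  let e := hφ.contDiffAt.toOpenPartialHomeomorph φ hd hn
  have he : ∀ z, e z = φ z := fun _ => rfl
  have hs : (0 : E) ∈ e.source := hφ.contDiffAt.mem_toOpenPartialHomeomorph_source hd hn
  have ht : (0 : E) ∈ e.target := by
    have := hφ.contDiffAt.image_mem_toOpenPartialHomeomorph_target hd hn
    rwa [h0] at this
  have hsymm0 : e.symm 0 = 0 := by
    have := e.left_inv hs
    rwa [he, h0] at this
  refine ⟨hφ, h0, e.symm, ?_, hsymm0, e.eventually_left_inverse hs, e.eventually_right_inverse ht⟩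
  have hcont : Filter.Tendsto e.symm (𝓝 0) (𝓝 0) := by
    have := e.continuousAt_symm ht
    rwa [ContinuousAt, hsymm0] at this
  -- A smooth germ must be smooth at all nearby points, so the inverse needs an invertible
  -- differential of `φ` near `0` and not only at `0`; invertibility is an open condition.
  have hinv : ∀ᶠ z in 𝓝 (0 : E), (fderiv ℝ φ z).IsInvertible := by
    have hc : ContinuousAt (fderiv ℝ φ) 0 :=
      (hφ.contDiffAt.fderiv_right (m := 0) (by simp)).continuousAt
    have ho := ContinuousLinearEquiv.nhds (𝕜 := ℝ) φ'
    rw [← hd.fderiv] at ho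
    filter_upwards [hc ho] with z hz
    obtain ⟨e', he'⟩ := hz
    exact ⟨e', he'⟩
  filter_upwards [hcont hinv, hcont hφ, e.open_target.mem_nhds ht] with z h1 h2 h3
  obtain ⟨e', he'⟩ := h1
  have h2' : ContDiffAt ℝ ∞ φ (e.symm z) := h2
  have hd' : HasFDerivAt e (e' : E →L[ℝ] E) (e.symm z) := by
    rw [he']
    exact (h2'.differentiableAt (by simp)).hasFDerivAt
  exact e.contDiffAt_symm h3 hd' h2'

theorem IsDiffeoGerm.tendsto {φ : E → E} (hφ : IsDiffeoGerm φ) :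
    Filter.Tendsto φ (𝓝 0) (𝓝 0) := by
  have := hφ.1.contDiffAt.continuousAt
  rwa [ContinuousAt, hφ.2.1] at this

theorem RightEquiv.symm {g h : E → ℝ} (H : RightEquiv g h) : RightEquiv h g := by
  obtain ⟨φ, ⟨hφ, h0, ψ, hψ, hψ0, h1, h2⟩, he⟩ := H
  have hψ' : IsDiffeoGerm ψ := ⟨hψ, hψ0, φ, hφ, h0, h2, h1⟩
  refine ⟨ψ, hψ', ?_⟩
  filter_upwards [hψ'.tendsto he, h2] with z hz hz2
  have : g (ψ z) = h (φ (ψ z)) := hz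
  rw [this, hz2]

theorem IsSmoothGermAt.comp {G : Type*} [NormedAddCommGroup G] [NormedSpace ℝ G] {f : E → F}
    {g : F → G} {x : E} (hg : IsSmoothGermAt g (f x)) (hf : IsSmoothGermAt f x) :
    IsSmoothGermAt (fun z => g (f z)) x := by
  filter_upwards [hf, hf.contDiffAt.continuousAt hg] with z h1 h2
  exact ContDiffAt.comp z h2 h1

end Germs

/-! ### The gradient inequality as an invariant of right equivalence -/

section GradientBound

variable {E : Type*} [NormedAddCommGroup E] [NormedSpace ℝ E]

/-- The gradient inequality `c ‖z‖ ^ k ≤ ‖dg(z)‖` near the origin. -/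
def GradientBound (k : ℕ) (g : E → ℝ) : Prop :=
  ∃ c : ℝ, 0 < c ∧ ∀ᶠ z in 𝓝 (0 : E), c * ‖z‖ ^ k ≤ ‖fderiv ℝ g z‖

theorem IsDiffeoGerm.exists_norm_le {φ : E → E} (hφ : IsDiffeoGerm φ) :
    ∃ K : ℝ, 0 < K ∧ ∀ᶠ z in 𝓝 (0 : E), ‖φ z‖ ≤ K * ‖z‖ := by
  have h := (hφ.1.contDiffAt.differentiableAt (by simp)).isBigO_sub
  simp only [hφ.2.1, sub_zero] at h
  obtain ⟨K, hK, h⟩ := h.exists_pos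
  exact ⟨K, hK, h.bound⟩

/-- By the chain rule `‖dg(z)‖ ≤ M ‖dh(φ z)‖`, where `M` bounds `dφ` near `0`. Putting `z = ψ w`
with `ψ` inverse to `φ`, and using `‖w‖ ≤ K ‖ψ w‖`, costs only the constant factor `1 / (M Kᵏ)`. -/
theorem GradientBound.of_rightEquiv {k : ℕ} {g h : E → ℝ} (hg : GradientBound k g)
    (hh : IsSmoothGermAt h 0) (H : RightEquiv g h) : GradientBound k h := by
  obtain ⟨φ, hφ, he⟩ := H
  obtain ⟨ψ, hψ, hψ0, h1, h2⟩ := hφ.2.2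
  have hψ' : IsDiffeoGerm ψ := ⟨hψ, hψ0, φ, hφ.1, hφ.2.1, h2, h1⟩
  obtain ⟨c, hc, hg⟩ := hg
  obtain ⟨K, hK, hb⟩ := hφ.exists_norm_le
  have hcont : ContinuousAt (fderiv ℝ φ) 0 :=
    (hφ.1.contDiffAt.fderiv_right (m := 0) (by simp)).continuousAt
  have hbd : ∀ᶠ z in 𝓝 (0 : E), ‖fderiv ℝ φ z‖ < ‖fderiv ℝ φ 0‖ + 1 :=
    hcont.norm.eventually_lt continuousAt_const (by simp)
  set M := ‖fderiv ℝ φ 0‖ + 1 with hM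
  have hM0 : 0 < M := by positivity
  refine ⟨c / (M * K ^ k), by positivity, ?_⟩
  have main : ∀ᶠ z in 𝓝 (0 : E), c * ‖z‖ ^ k ≤ M * ‖fderiv ℝ h (φ z)‖ := by
    filter_upwards [hg, hbd, he.eventually_nhds, hφ.tendsto hh, hφ.1] with z a1 a2 a3 a4 a5
    have a4' : ContDiffAt ℝ ∞ h (φ z) := a4
    have e1 : fderiv ℝ g z = (fderiv ℝ h (φ z)).comp (fderiv ℝ φ z) := by
      have : g =ᶠ[𝓝 z] h ∘ φ := a3
      rw [this.fderiv_eq]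
      exact fderiv_comp z (a4'.differentiableAt (by simp)) (a5.differentiableAt (by simp))
    calc c * ‖z‖ ^ k ≤ ‖fderiv ℝ g z‖ := a1
      _ ≤ ‖fderiv ℝ h (φ z)‖ * ‖fderiv ℝ φ z‖ := by
        rw [e1]; exact ContinuousLinearMap.opNorm_comp_le _ _
      _ ≤ ‖fderiv ℝ h (φ z)‖ * M := by gcongr
      _ = _ := mul_comm _ _
  filter_upwards [hψ'.tendsto main, hψ'.tendsto hb, h2] with w b1 b2 b3
  have b1' : c * ‖ψ w‖ ^ k ≤ M * ‖fderiv ℝ h (φ (ψ w))‖ := b1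
  have b2' : ‖φ (ψ w)‖ ≤ K * ‖ψ w‖ := b2
  rw [b3] at b1' b2'
  rw [div_mul_eq_mul_div, div_le_iff₀ (by positivity)]
  calc c * ‖w‖ ^ k ≤ c * (K * ‖ψ w‖) ^ k := by gcongr
    _ = K ^ k * (c * ‖ψ w‖ ^ k) := by ring
    _ ≤ K ^ k * (M * ‖fderiv ℝ h w‖) := by gcongr
    _ = _ := by ring

end GradientBound

/-- The function `(s, t) ↦ s² + η t^m`. -/
def powerModel (η : ℝ) (m : ℕ) (z : ℝ × ℝ) : ℝ := z.1 ^ 2 + η * z.2 ^ m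

theorem powerModel_smooth (η : ℝ) (m : ℕ) : IsSmoothGermAt (powerModel η m) 0 := by
  apply isSmoothGermAt_of_contDiff
  unfold powerModel
  fun_prop

theorem fderiv_powerModel (η : ℝ) (m : ℕ) (z : ℝ × ℝ) :
    fderiv ℝ (powerModel η m) z = (2 * z.1) • ContinuousLinearMap.fst ℝ ℝ ℝ +
      (η * (m * z.2 ^ (m - 1))) • ContinuousLinearMap.snd ℝ ℝ ℝ := by
  have h1 : HasFDerivAt (fun z : ℝ × ℝ => z.1) (ContinuousLinearMap.fst ℝ ℝ ℝ) z :=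
    hasFDerivAt_fst
  have h2 : HasFDerivAt (fun z : ℝ × ℝ => z.2) (ContinuousLinearMap.snd ℝ ℝ ℝ) z :=
    hasFDerivAt_snd
  have h := (h1.pow 2).add ((h2.pow m).const_mul η)
  have h' : HasFDerivAt (powerModel η m) _ z := h
  rw [h'.fderiv]
  ext <;> simp

/-- The norm on `ℝ × ℝ` is the maximum norm, so it suffices to use the partial derivative in the
larger coordinate: `2|s|`, which dominates `|s|ᵏ` on the unit ball, or `(k + 1)|t|ᵏ`. -/
theorem gradientBound_powerModel {η : ℝ} (hη : η = 1 ∨ η = -1) {k : ℕ} (hk : 1 ≤ k) :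
    GradientBound k (powerModel η (k + 1)) := by
  refine ⟨1, one_pos, ?_⟩
  filter_upwards [Metric.ball_mem_nhds (0 : ℝ × ℝ) one_pos] with z hz
  have hz1 : ‖z‖ ≤ 1 := by simpa using (mem_ball_zero_iff.1 hz).le
  rw [fderiv_powerModel, one_mul]
  set D := (2 * z.1) • ContinuousLinearMap.fst ℝ ℝ ℝ +
      (η * ((k + 1 : ℕ) * z.2 ^ (k + 1 - 1))) • ContinuousLinearMap.snd ℝ ℝ ℝ with hD
  have e1 : ‖D (1, 0)‖ ≤ ‖D‖ * 1 := by
    simpa using D.le_opNorm ((1 : ℝ), (0 : ℝ))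
  have e2 : ‖D (0, 1)‖ ≤ ‖D‖ * 1 := by
    simpa using D.le_opNorm ((0 : ℝ), (1 : ℝ))
  have d1 : ‖D (1, 0)‖ = 2 * |z.1| := by simp [hD]
  have d2 : ‖D (0, 1)‖ = (k + 1) * |z.2| ^ k := by
    have : |(k : ℝ) + 1| = k + 1 := abs_of_nonneg (by positivity)
    rcases hη with rfl | rfl <;> simp [hD, this]
  rw [d1] at e1
  rw [d2] at e2
  rw [Prod.norm_def] at hz1 ⊢
  rcases max_cases ‖z.1‖ ‖z.2‖ with ⟨h, _⟩ | ⟨h, _⟩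
  · rw [h] at hz1 ⊢
    calc ‖z.1‖ ^ k ≤ ‖z.1‖ ^ 1 := pow_le_pow_of_le_one (norm_nonneg _) hz1 hk
      _ ≤ 2 * |z.1| := by simp; linarith [abs_nonneg z.1]
      _ ≤ ‖D‖ := by linarith
  · rw [h]
    calc ‖z.2‖ ^ k ≤ (k + 1) * |z.2| ^ k := by
          rw [Real.norm_eq_abs]
          nlinarith [pow_nonneg (abs_nonneg z.2) k, (Nat.cast_nonneg k : (0 : ℝ) ≤ k)]
      _ ≤ ‖D‖ := by linarith

/-- A curve along which the gradient is small obstructs the gradient inequality. -/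
theorem not_gradientBound_of_curve {g : ℝ × ℝ → ℝ} {j m : ℕ} (hjm : j < m) {c : ℝ → ℝ × ℝ}
    (hc : Filter.Tendsto c (𝓝 0) (𝓝 0)) (hlow : ∀ t, |t| ≤ ‖c t‖)
    (hO : (fun t => fderiv ℝ g (c t)) =O[𝓝 0] fun t => t ^ m) : ¬ GradientBound j g := by
  rintro ⟨a, ha, h⟩
  obtain ⟨K, hK, hb⟩ := hO.exists_pos
  have h1 : ∀ᶠ t in 𝓝 (0 : ℝ), a * |t| ^ j ≤ K * |t| ^ m := by
    filter_upwards [hc h, hb.bound] with t h1 h2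
    have h1' : a * ‖c t‖ ^ j ≤ ‖fderiv ℝ g (c t)‖ := h1
    calc a * |t| ^ j ≤ a * ‖c t‖ ^ j := by gcongr; exact hlow t
      _ ≤ K * ‖t ^ m‖ := h1'.trans h2
      _ = K * |t| ^ m := by simp
  have h2 : ∀ᶠ t in 𝓝 (0 : ℝ), K * |t| ^ (m - j) < a := by
    have hcont : Continuous fun t : ℝ => K * |t| ^ (m - j) := by fun_prop
    have := hcont.tendsto 0
    rw [abs_zero, zero_pow (by omega), mul_zero] at this
    exact this.eventually_lt_const ha
  have h3 : ∀ᶠ t in 𝓝[≠] (0 : ℝ), False := by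
    filter_upwards [h1.filter_mono nhdsWithin_le_nhds, h2.filter_mono nhdsWithin_le_nhds,
      self_mem_nhdsWithin] with t a1 a2 a3
    have a3' : 0 < |t| := abs_pos.2 a3
    have : |t| ^ m = |t| ^ (m - j) * |t| ^ j := by rw [← pow_add]; congr 1; omega
    rw [this, ← mul_assoc] at a1
    have := le_of_mul_le_mul_right a1 (pow_pos a3' j)
    linarith
  exact h3.exists.elim fun _ h => h

/-- On the `t`-axis the gradient has size `O(tᵏ)`. So `k` is the least admissible exponent of the
model, and this separates the types `A_k` for different `k`. -/
theorem not_gradientBound_powerModel (η : ℝ) {j k : ℕ} (hjk : j < k) :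
    ¬ GradientBound j (powerModel η (k + 1)) := by
  refine not_gradientBound_of_curve hjk (c := fun t => (0, t)) ?_ ?_ ?_
  · exact (Continuous.tendsto' (by fun_prop) _ _ rfl)
  · intro t; simp [Prod.norm_def]
  · simp only [fderiv_powerModel]
    refine IsBigO.of_bound (|η| * (k + 1) * ‖ContinuousLinearMap.snd ℝ ℝ ℝ‖) ?_
    refine Filter.Eventually.of_forall fun t => ?_
    have : |(k : ℝ) + 1| = k + 1 := abs_of_nonneg (by positivity)
    simp only [mul_zero, zero_smul, zero_add, norm_smul, norm_mul, Nat.add_sub_cancel,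
      Real.norm_eq_abs, Nat.cast_add, Nat.cast_one, this, abs_pow]
    apply le_of_eq
    ring

/-! ### Second order information -/

theorem fderiv_clm_sq_mul (ℓ : ℝ × ℝ →L[ℝ] ℝ) {α : ℝ × ℝ → ℝ} (hα : ContDiff ℝ ∞ α)
    (z : ℝ × ℝ) : HasFDerivAt (fun z => ℓ z ^ 2 * α z)
      ((2 * ℓ z * α z) • ℓ + (ℓ z ^ 2) • fderiv ℝ α z) z := by
  have h := (ℓ.hasFDerivAt (x := z).pow 2).mul (hα.differentiable (by simp) z).hasFDerivAt
  refine h.congr_fderiv ?_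
  ext <;> simp <;> ring

theorem isBigO_fderiv_clm_sq_mul (ℓ : ℝ × ℝ →L[ℝ] ℝ) {α : ℝ × ℝ → ℝ} (hα : ContDiff ℝ ∞ α) :
    (fun z => fderiv ℝ (fun z => ℓ z ^ 2 * α z) z - (2 * α 0 * ℓ z) • ℓ)
      =O[𝓝 0] fun z => ‖z‖ ^ 2 := by
  have hℓ : (fun z : ℝ × ℝ => ℓ z) =O[𝓝 0] fun z => ‖z‖ := (ℓ.isBigO_id _).norm_right
  have h1 : (fun z => α z - α 0) =O[𝓝 0] fun z => ‖z‖ := by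
    have := (hα.differentiable (by simp) 0).isBigO_sub
    simpa using this.norm_right
  have h2 : (fun z => fderiv ℝ α z) =O[𝓝 0] fun _ => (1 : ℝ) :=
    ((hα.continuous_fderiv (by simp)).continuousAt).isBigO_one ℝ
  have hA : (fun z => (2 * ℓ z * (α z - α 0)) • ℓ) =O[𝓝 0] fun z => ‖z‖ ^ 2 := by
    have : (fun z => 2 * ℓ z * (α z - α 0)) =O[𝓝 0] fun z : ℝ × ℝ => ‖z‖ * ‖z‖ :=
      (hℓ.const_mul_left 2).mul h1
    have := this.smul (isBigO_const_const ℓ (one_ne_zero (α := ℝ)) (𝓝 0))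
    simpa [sq] using this
  have hB : (fun z => (ℓ z ^ 2) • fderiv ℝ α z) =O[𝓝 0] fun z => ‖z‖ ^ 2 := by
    simpa using (hℓ.pow 2).smul h2
  refine (hA.add hB).congr_left fun z => ?_
  rw [(fderiv_clm_sq_mul ℓ hα z).fderiv]
  ext <;> simp <;> ring

/-- The `2`-jet of `g` at the origin is `G₀ + G₁ s + A s² + T t²`. -/
def HasDiagonalJet (g : ℝ × ℝ → ℝ) (G₀ G₁ A T : ℝ) : Prop :=
  ∃ α β : ℝ × ℝ → ℝ, ContDiff ℝ ∞ α ∧ ContDiff ℝ ∞ β ∧ α 0 = A ∧ β 0 = T ∧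
    ∀ᶠ z in 𝓝 (0 : ℝ × ℝ), g z = G₀ + G₁ * z.1 + z.1 ^ 2 * α z + z.2 ^ 2 * β z

namespace HasDiagonalJet

variable {g : ℝ × ℝ → ℝ} {G₀ G₁ A T : ℝ}

theorem smooth (h : HasDiagonalJet g G₀ G₁ A T) : IsSmoothGermAt g 0 := by
  obtain ⟨α, β, hα, hβ, -, -, he⟩ := h
  have : ContDiff ℝ ∞ fun z : ℝ × ℝ => G₀ + G₁ * z.1 + z.1 ^ 2 * α z + z.2 ^ 2 * β z := by
    fun_prop
  filter_upwards [he.eventually_nhds] with z hz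
  exact this.contDiffAt.congr_of_eventuallyEq hz

theorem apply_zero (h : HasDiagonalJet g G₀ G₁ A T) : g 0 = G₀ := by
  obtain ⟨α, β, hα, hβ, -, -, he⟩ := h
  simpa using he.self_of_nhds

theorem isBigO_fderiv (h : HasDiagonalJet g G₀ G₁ A T) :
    (fun z => fderiv ℝ g z - (G₁ • ContinuousLinearMap.fst ℝ ℝ ℝ +
      (2 * A * z.1) • ContinuousLinearMap.fst ℝ ℝ ℝ +
      (2 * T * z.2) • ContinuousLinearMap.snd ℝ ℝ ℝ)) =O[𝓝 0] fun z => ‖z‖ ^ 2 := by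
  obtain ⟨α, β, hα, hβ, rfl, rfl, he⟩ := h
  have h1 := isBigO_fderiv_clm_sq_mul (ContinuousLinearMap.fst ℝ ℝ ℝ) hα
  have h2 := isBigO_fderiv_clm_sq_mul (ContinuousLinearMap.snd ℝ ℝ ℝ) hβ
  refine (h1.add h2).congr' ?_ Filter.EventuallyEq.rfl
  filter_upwards [he.eventually_nhds] with z hz
  have hz' : g =ᶠ[𝓝 z] fun z => G₀ + G₁ * z.1 + z.1 ^ 2 * α z + z.2 ^ 2 * β z := hz
  have d1 := fderiv_clm_sq_mul (ContinuousLinearMap.fst ℝ ℝ ℝ) hα z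
  have d2 := fderiv_clm_sq_mul (ContinuousLinearMap.snd ℝ ℝ ℝ) hβ z
  have d0 : HasFDerivAt (fun z : ℝ × ℝ => G₀ + G₁ * z.1)
      (G₁ • ContinuousLinearMap.fst ℝ ℝ ℝ) z :=
    ((hasFDerivAt_fst (p := z)).const_mul G₁).const_add G₀
  have d := (d0.add d1).add d2
  have d' : HasFDerivAt (fun z => G₀ + G₁ * z.1 + z.1 ^ 2 * α z + z.2 ^ 2 * β z) _ z := d
  rw [hz'.fderiv_eq, d'.fderiv, d1.fderiv, d2.fderiv]
  ext <;> simp <;> ring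

theorem fderiv_zero (h : HasDiagonalJet g G₀ G₁ A T) :
    fderiv ℝ g 0 = G₁ • ContinuousLinearMap.fst ℝ ℝ ℝ := by
  obtain ⟨K, hK⟩ := h.isBigO_fderiv.bound
  have := hK.self_of_nhds
  simp only [norm_zero, Prod.fst_zero, Prod.snd_zero, mul_zero, zero_smul, add_zero] at this
  rw [← sub_eq_zero, ← norm_le_zero_iff]
  simpa using this

theorem hasFDerivAt_fderiv (h : HasDiagonalJet g G₀ G₁ A T) :
    HasFDerivAt (fderiv ℝ g)
      ((2 * A) • (ContinuousLinearMap.fst ℝ ℝ ℝ).smulRight (ContinuousLinearMap.fst ℝ ℝ ℝ) +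
        (2 * T) • (ContinuousLinearMap.snd ℝ ℝ ℝ).smulRight (ContinuousLinearMap.snd ℝ ℝ ℝ)) 0 := by
  have h1 := h.isBigO_fderiv
  have h2 : HasFDerivAt (𝕜 := ℝ) (fun z => fderiv ℝ g z - (G₁ • ContinuousLinearMap.fst ℝ ℝ ℝ +
      (2 * A * z.1) • ContinuousLinearMap.fst ℝ ℝ ℝ +
      (2 * T * z.2) • ContinuousLinearMap.snd ℝ ℝ ℝ)) 0 (0 : ℝ × ℝ) := by
    refine IsBigO.hasFDerivAt (𝕜 := ℝ) (n := 2) ?_ (by norm_num)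
    simpa using h1
  let D : ℝ × ℝ →L[ℝ] ℝ × ℝ →L[ℝ] ℝ :=
    (2 * A) • (ContinuousLinearMap.fst ℝ ℝ ℝ).smulRight (ContinuousLinearMap.fst ℝ ℝ ℝ) +
      (2 * T) • (ContinuousLinearMap.snd ℝ ℝ ℝ).smulRight (ContinuousLinearMap.snd ℝ ℝ ℝ)
  have h3 := h2.add ((D.hasFDerivAt (x := (0 : ℝ × ℝ))).const_add
    (G₁ • ContinuousLinearMap.fst ℝ ℝ ℝ))
  rw [zero_add] at h3
  refine h3.congr_of_eventuallyEq (Filter.Eventually.of_forall fun z => ?_)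
  ext <;> simp [D]

theorem hessianKernel_eq_iff (h : HasDiagonalJet g G₀ G₁ A T) :
    hessianKernel g = Submodule.span ℝ {((0 : ℝ), (1 : ℝ))} ↔ A ≠ 0 ∧ T = 0 := by
  have hk : ∀ v : ℝ × ℝ, v ∈ hessianKernel g ↔ A * v.1 = 0 ∧ T * v.2 = 0 := by
    intro v
    unfold hessianKernel
    rw [h.hasFDerivAt_fderiv.fderiv, LinearMap.mem_ker]
    constructor
    · intro hv
      have e1 := DFunLike.congr_fun hv ((1 : ℝ), (0 : ℝ))
      have e2 := DFunLike.congr_fun hv ((0 : ℝ), (1 : ℝ))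
      simp at e1 e2
      simpa using ⟨e1, e2⟩
    · rintro ⟨e1, e2⟩
      ext
      · simpa using e1
      · simpa using e2
  constructor
  · intro he
    constructor
    · rintro rfl
      have : ((1 : ℝ), (0 : ℝ)) ∈ hessianKernel g := (hk _).2 (by simp)
      rw [he, Submodule.mem_span_singleton] at this
      obtain ⟨a, ha⟩ := this
      simp at ha
    · have : ((0 : ℝ), (1 : ℝ)) ∈ hessianKernel g := by
        rw [he]; exact Submodule.mem_span_singleton_self _
      simpa using ((hk _).1 this).2
  · rintro ⟨hA, rfl⟩
    ext v
    rw [hk, Submodule.mem_span_singleton]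
    constructor
    · rintro ⟨e, -⟩
      exact ⟨v.2, by ext <;> simp_all⟩
    · rintro ⟨a, rfl⟩
      simp

/-- If the diagonal Hessian degenerates, one coordinate axis lies in its kernel, and along that axis
the gradient is quadratically small. -/
theorem not_gradientBound_one (h : HasDiagonalJet g G₀ 0 A T) (hAT : A = 0 ∨ T = 0) :
    ¬ GradientBound 1 g := by
  have key : ∀ c : ℝ → ℝ × ℝ, Filter.Tendsto c (𝓝 0) (𝓝 0) → (∀ t, |t| = ‖c t‖) →
      (∀ t, A * (c t).1 = 0 ∧ T * (c t).2 = 0) → ¬ GradientBound 1 g := by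
    intro c hc hn h0
    refine not_gradientBound_of_curve (m := 2) (by norm_num) hc (fun t => (hn t).le) ?_
    have := h.isBigO_fderiv.comp_tendsto hc
    refine (this.congr' (Filter.Eventually.of_forall fun t => ?_)
      (Filter.Eventually.of_forall fun t => ?_))
    · simp only [Function.comp]
      rw [mul_assoc, (h0 t).1, mul_assoc, (h0 t).2]
      simp
    · simp only [Function.comp]
      rw [← hn, sq_abs]
  rcases hAT with rfl | rfl
  · exact key (fun t => (t, 0)) (Continuous.tendsto' (by fun_prop) _ _ rfl)
      (fun t => by simp [Prod.norm_def]) (fun t => by simp)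
  · exact key (fun t => (0, t)) (Continuous.tendsto' (by fun_prop) _ _ rfl)
      (fun t => by simp [Prod.norm_def]) (fun t => by simp)

/-- A germ right equivalent to `s² + η t^m` with `m ≥ 2` is critical at the origin. -/
theorem critical_of_rightEquiv (h : HasDiagonalJet g G₀ G₁ A T) {η : ℝ} {m : ℕ} (hm : 2 ≤ m)
    (H : RightEquiv g (powerModel η m)) : G₀ = 0 ∧ G₁ = 0 := by
  obtain ⟨φ, hφ, he⟩ := H
  constructor
  · rw [← h.apply_zero, he.self_of_nhds, hφ.2.1]
    simp [powerModel]
    right; omega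
  · have e1 : fderiv ℝ g 0 = 0 := by
      have : g =ᶠ[𝓝 0] powerModel η m ∘ φ := he
      rw [this.fderiv_eq, fderiv_comp _ ((powerModel_smooth η m).contDiffAt.differentiableAt
        (by simp) |> fun h => by rwa [hφ.2.1])
        (hφ.1.contDiffAt.differentiableAt (by simp)), hφ.2.1, fderiv_powerModel]
      have : (0 : ℝ) ^ (m - 1) = 0 := zero_pow (by omega)
      simp [this]
    rw [h.fderiv_zero] at e1
    simpa using DFunLike.congr_fun e1 ((1 : ℝ), (0 : ℝ))

/-- A germ right equivalent to `s² + η t^m` has a positive direction for its Hessian. -/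
theorem pos_of_rightEquiv (h : HasDiagonalJet g 0 0 A T) {η : ℝ} {m : ℕ} (hm : m ≠ 0)
    (H : RightEquiv g (powerModel η m)) : 0 < A ∨ 0 < T := by
  by_contra! hneg
  obtain ⟨ψ, hψ, he⟩ := H.symm
  obtain ⟨α, β, hα, hβ, rfl, rfl, hg⟩ := h
  obtain ⟨K, hK, hb⟩ := hψ.exists_norm_le
  -- If `A, T ≤ 0`, both coefficient functions are below `e` near `0`. With `w = ψ(x, 0)` and `‖w‖ ≤
  -- K|x|` this gives `x² ≤ 2e‖w‖² ≤ 2eK²x²`, and the choice of `e` makes the right side `x²/2`.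
  set e : ℝ := 1 / (4 * K ^ 2) with hedef
  have he0 : 0 < e := by positivity
  have ha : ∀ᶠ z in 𝓝 (0 : ℝ × ℝ), α z < e :=
    hα.continuous.continuousAt.eventually_lt continuousAt_const (by linarith [hneg.1])
  have hb' : ∀ᶠ z in 𝓝 (0 : ℝ × ℝ), β z < e :=
    hβ.continuous.continuousAt.eventually_lt continuousAt_const (by linarith [hneg.2])
  have hx : Filter.Tendsto (fun x : ℝ => (x, (0 : ℝ))) (𝓝 0) (𝓝 0) :=
    Continuous.tendsto' (by fun_prop) _ _ rfl
  have h3 : ∀ᶠ x in 𝓝[≠] (0 : ℝ), False := by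
    filter_upwards [nhdsWithin_le_nhds (hx he),
      nhdsWithin_le_nhds (hx hb),
      nhdsWithin_le_nhds (hx (hψ.tendsto (hg.and (ha.and hb')))),
      self_mem_nhdsWithin] with x a1 a2 a3 a4
    replace a1 : powerModel η m (x, 0) = g (ψ (x, 0)) := a1
    replace a2 : ‖ψ (x, 0)‖ ≤ K * ‖(x, (0 : ℝ))‖ := a2
    obtain ⟨b1, b2, b3⟩ := a3
    replace b2 : α (ψ (x, 0)) < e := b2
    replace b3 : β (ψ (x, 0)) < e := b3
    rw [b1] at a1
    simp only [powerModel, zero_pow hm] at a1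
    have n1 : ‖(x, (0 : ℝ))‖ = |x| := by simp [Prod.norm_def]
    rw [n1] at a2
    set w := ψ (x, 0) with hw
    have c1 : w.1 ^ 2 ≤ ‖w‖ ^ 2 := by
      rw [← sq_abs w.1]; gcongr; exact norm_fst_le w
    have c2 : w.2 ^ 2 ≤ ‖w‖ ^ 2 := by
      rw [← sq_abs w.2]; gcongr; exact norm_snd_le w
    have c3 : ‖w‖ ^ 2 ≤ K ^ 2 * x ^ 2 := by
      rw [← sq_abs x, ← mul_pow]; gcongr
    have hx0 : 0 < x ^ 2 := by
      have : x ≠ 0 := a4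
      positivity
    have c4 : x ^ 2 ≤ 2 * e * ‖w‖ ^ 2 := by
      nlinarith [mul_nonneg (sq_nonneg w.1) (sub_nonneg.2 b2.le),
        mul_nonneg (sq_nonneg w.2) (sub_nonneg.2 b3.le)]
    have c5 : 2 * e * (K ^ 2 * x ^ 2) = x ^ 2 / 2 := by
      rw [hedef]; field_simp; norm_num
    have c6 : 2 * e * ‖w‖ ^ 2 ≤ 2 * e * (K ^ 2 * x ^ 2) := by gcongr
    linarith
  exact h3.exists.elim fun _ h => h

end HasDiagonalJet

/-! ### The splitting lemma for germs with a weighted jet -/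

theorem isDiffeoGerm_of_injective {E : Type*} [NormedAddCommGroup E] [NormedSpace ℝ E]
    [FiniteDimensional ℝ E] {φ : E → E} (hφ : IsSmoothGermAt φ 0) (h0 : φ 0 = 0)
    {D : E →L[ℝ] E} (hd : HasFDerivAt φ D 0) (hD : ∀ v, D v = 0 → v = 0) : IsDiffeoGerm φ := by
  have hinj : Function.Injective D.toLinearMap := by
    rw [← LinearMap.ker_eq_bot, LinearMap.ker_eq_bot']
    exact hD
  have := FiniteDimensional.complete ℝ E
  refine isDiffeoGerm_of_hasFDerivAt hφ h0
    (LinearEquiv.ofInjectiveEndo D.toLinearMap hinj).toContinuousLinearEquiv ?_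
  convert hd using 1
  ext v
  simp

/-- Serves to compare Taylor coefficients: an identity is divided by a power of `t` for `t ≠ 0`, and
continuity recovers the value at `0`. -/
theorem eq_zero_of_eventually_punctured {u : ℝ → ℝ} (hu : Continuous u)
    (h : ∀ᶠ t in 𝓝[≠] (0 : ℝ), u t = 0) : u 0 = 0 := by
  have h1 : Filter.Tendsto u (𝓝[≠] 0) (𝓝 (u 0)) := (hu.tendsto 0).mono_left nhdsWithin_le_nhds
  have h2 : Filter.Tendsto u (𝓝[≠] 0) (𝓝 0) :=
    tendsto_const_nhds.congr' (h.mono fun t ht => ht.symm)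
  exact tendsto_nhds_unique h1 h2

/-- With weights `2` and `1` for `s` and `t`, the jet of `g` of weighted degree at most five is
`G₀ + G₁ s + A s² + T t² + B s t² + C t⁴ + E s t³ + F t⁵`. -/
def HasWeightedJet (g : ℝ × ℝ → ℝ) (G₀ G₁ A T B C E F : ℝ) : Prop :=
  ∃ r₀ ρ r R : ℝ × ℝ → ℝ, ContDiff ℝ ∞ r₀ ∧ ContDiff ℝ ∞ ρ ∧ ContDiff ℝ ∞ r ∧ ContDiff ℝ ∞ R ∧
    ∀ᶠ z in 𝓝 (0 : ℝ × ℝ), g z = G₀ + G₁ * z.1 + A * z.1 ^ 2 + T * z.2 ^ 2 + B * z.1 * z.2 ^ 2 +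
      C * z.2 ^ 4 + E * z.1 * z.2 ^ 3 + F * z.2 ^ 5 +
      (z.1 ^ 3 * r₀ z + z.1 ^ 2 * z.2 ^ 2 * ρ z + z.1 * z.2 ^ 4 * r z + z.2 ^ 6 * R z)

/-- Smooth choice of the critical point in the first variable. -/
theorem exists_critical_curve {g : ℝ × ℝ → ℝ} (hg : ContDiff ℝ ∞ g) {G₀ A T : ℝ}
    (h : HasDiagonalJet g G₀ 0 A T) (hA : A ≠ 0) :
    ∃ σ : ℝ → ℝ, ContDiff ℝ ∞ σ ∧ σ 0 = 0 ∧
      ∀ᶠ t in 𝓝 (0 : ℝ), fderiv ℝ g (σ t, t) (1, 0) = 0 := by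
  -- Implicit function theorem by way of the inverse one: `(∂ₛg, t)` is a local coordinate system
  -- because `∂ₛ²g(0) = 2A ≠ 0`, and the critical curve is the preimage of the axis where the first
  -- coordinate is `0`.
  let φ : ℝ × ℝ → ℝ × ℝ := fun z => (fderiv ℝ g z (1, 0), z.2)
  have hD : ContDiff ℝ ∞ fun z => fderiv ℝ g z (1, 0) :=
    (hg.fderiv_right (m := ∞) (by simp)).clm_apply contDiff_const
  have hφs : ContDiff ℝ ∞ φ := hD.prodMk contDiff_snd
  have hφ0 : φ 0 = 0 := by
    simp only [φ]
    rw [h.fderiv_zero]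
    simp
  have hd1 : HasFDerivAt (fun z => fderiv ℝ g z (1, 0))
      ((2 * A) • ContinuousLinearMap.fst ℝ ℝ ℝ) 0 := by
    have := h.hasFDerivAt_fderiv.clm_apply (hasFDerivAt_const ((1 : ℝ), (0 : ℝ)) (0 : ℝ × ℝ))
    refine this.congr_fderiv ?_
    ext <;> simp
  have hφ : IsDiffeoGerm φ := by
    refine isDiffeoGerm_of_injective (isSmoothGermAt_of_contDiff hφs 0) hφ0
      (hd1.prodMk hasFDerivAt_snd) ?_
    intro v hv
    simp at hv
    ext
    · simpa [hA] using hv.1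
    · simpa using hv.2
  obtain ⟨ψ, hψ, hψ0, -, h2⟩ := hφ.2.2
  have hx : IsSmoothGermAt (fun t : ℝ => ((0 : ℝ), t)) 0 :=
    isSmoothGermAt_of_contDiff (contDiff_const.prodMk contDiff_id) 0
  have hs1 : IsSmoothGermAt (fun t : ℝ => ψ (0, t)) 0 := IsSmoothGermAt.comp (g := ψ) hψ hx
  have hs : IsSmoothGermAt (fun t : ℝ => (ψ (0, t)).1) 0 :=
    IsSmoothGermAt.comp (g := Prod.fst) (isSmoothGermAt_of_contDiff contDiff_fst _) hs1
  obtain ⟨σ, hσ, hσe⟩ := hs.exists_contDiff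
  refine ⟨σ, hσ, ?_, ?_⟩
  · rw [← hσe.self_of_nhds]
    have : ψ (0, 0) = 0 := hψ0
    change (ψ (0, 0)).1 = 0
    rw [this]; rfl
  · have hx' : Filter.Tendsto (fun t : ℝ => ((0 : ℝ), t)) (𝓝 0) (𝓝 0) :=
      Continuous.tendsto' (by fun_prop) _ _ rfl
    filter_upwards [hσe, hx' h2] with t a1 a2
    have a2' : φ (ψ (0, t)) = (0, t) := a2
    simp only [φ, Prod.mk.injEq] at a2'
    have : (σ t, t) = ψ (0, t) := by
      ext
      · exact a1.symm
      · exact a2'.2.symm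
    rw [this]
    exact a2'.1

/-- The splitting lemma in two variables. -/
theorem exists_splitting {g : ℝ × ℝ → ℝ} (hg : ContDiff ℝ ∞ g) {σ : ℝ → ℝ} (hσ : ContDiff ℝ ∞ σ)
    (hcrit : ∀ᶠ t in 𝓝 (0 : ℝ), fderiv ℝ g (σ t, t) (1, 0) = 0) :
    ∃ Q : ℝ × ℝ → ℝ, ContDiff ℝ ∞ Q ∧
      ∀ᶠ t in 𝓝 (0 : ℝ), ∀ s, g (s, t) = g (σ t, t) + (s - σ t) ^ 2 * Q (s, t) := by
  -- After recentring `s` at `σ(t)`, two divisions by `s` are possible: the first quotient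
  -- restricted to `s = 0` is `∂ₛg` on the critical curve, which vanishes.
  have hsh : ContDiff ℝ ∞ fun z : ℝ × ℝ => g (σ z.2 + z.1, z.2) :=
    hg.comp (((hσ.comp contDiff_snd).add contDiff_fst).prodMk contDiff_snd)
  obtain ⟨R₁, hR₁, e₁⟩ := exists_eq_add_fst_smul hsh
  obtain ⟨R₂, hR₂, e₂⟩ := exists_eq_add_fst_smul hR₁
  refine ⟨fun z => R₂ (z.1 - σ z.2, z.2), hR₂.comp
    ((contDiff_fst.sub (hσ.comp contDiff_snd)).prodMk contDiff_snd), ?_⟩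
  filter_upwards [hcrit] with t ht s
  have hzero : R₁ (0, t) = 0 := by
    have d1 : HasDerivAt (fun x : ℝ => g (σ t + x, t)) 0 0 := by
      have h1 : HasDerivAt (fun x : ℝ => (σ t + x, t)) (1, 0) 0 :=
        ((hasDerivAt_id (0 : ℝ)).const_add (σ t)).prodMk (hasDerivAt_const _ t)
      have h2 := ((hg.differentiable (by simp)) (σ t + 0, t)).hasFDerivAt.comp_hasDerivAt 0 h1
      rw [add_zero, ht] at h2
      exact h2
    have d2 : HasDerivAt (fun x : ℝ => g (σ t + x, t)) (R₁ (0, t)) 0 := by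
      have h1 : HasDerivAt (fun x : ℝ => (x, t)) (1, 0) 0 :=
        (hasDerivAt_id (0 : ℝ)).prodMk (hasDerivAt_const _ t)
      have h2 := ((hR₁.differentiable (by simp)) (0, t)).hasFDerivAt.comp_hasDerivAt 0 h1
      have h3 := ((hasDerivAt_id (0 : ℝ)).mul h2).const_add (g (σ t + 0, t))
      simp only [id, one_mul, zero_mul, add_zero, Function.comp] at h3
      refine h3.congr_of_eventuallyEq (Filter.Eventually.of_forall fun x => ?_)
      have := e₁ (x, t)
      simpa using this
    exact d2.unique d1
  have a1 := e₁ (s - σ t, t)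
  have a2 := e₂ (s - σ t, t)
  simp only [hzero, smul_eq_mul, zero_add] at a1 a2
  rw [a2] at a1
  simp only [add_sub_cancel, add_zero] at a1
  rw [a1]; ring

namespace HasWeightedJet

variable {g : ℝ × ℝ → ℝ} {G₀ G₁ A T B C E F : ℝ}

theorem neg (h : HasWeightedJet g G₀ G₁ A T B C E F) :
    HasWeightedJet (-g) (-G₀) (-G₁) (-A) (-T) (-B) (-C) (-E) (-F) := by
  obtain ⟨r₀, ρ, r, R, h1, h2, h3, h4, he⟩ := h
  refine ⟨-r₀, -ρ, -r, -R, h1.neg, h2.neg, h3.neg, h4.neg, ?_⟩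
  filter_upwards [he] with z hz
  simp only [Pi.neg_apply, hz]
  ring

theorem hasDiagonalJet (h : HasWeightedJet g G₀ G₁ A T B C E F) :
    HasDiagonalJet g G₀ G₁ A T := by
  obtain ⟨r₀, ρ, r, R, h1, h2, h3, h4, he⟩ := h
  refine ⟨fun z => A + z.1 * r₀ z + z.2 ^ 2 * ρ z, fun z => T + B * z.1 + C * z.2 ^ 2 +
    E * z.1 * z.2 + F * z.2 ^ 3 + z.1 * z.2 ^ 2 * r z + z.2 ^ 4 * R z, by fun_prop, by fun_prop,
    by simp, by simp, ?_⟩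
  filter_upwards [he] with z hz
  rw [hz]
  ring

theorem hasDerivAt_slice_fst {r : ℝ × ℝ → ℝ} (hr : ContDiff ℝ ∞ r) (s t : ℝ) :
    HasDerivAt (fun x => r (x, t)) (fderiv ℝ r (s, t) (1, 0)) s :=
  ((hr.differentiable (by simp)) (s, t)).hasFDerivAt.comp_hasDerivAt s
    ((hasDerivAt_id s).prodMk (hasDerivAt_const _ t))

/-- Normal form of a germ with non-vanishing second derivative in the first variable. -/
theorem exists_split (h : HasWeightedJet g 0 0 A T B C E F) (hA : A ≠ 0) :
    ∃ (σ w : ℝ → ℝ) (Q : ℝ × ℝ → ℝ), ContDiff ℝ ∞ σ ∧ ContDiff ℝ ∞ w ∧ ContDiff ℝ ∞ Q ∧ σ 0 = 0 ∧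
      Q 0 = A ∧ ∀ᶠ z in 𝓝 (0 : ℝ × ℝ), g z = (T * z.2 ^ 2 + (C - B ^ 2 / (4 * A)) * z.2 ^ 4 +
        (F - E * B / (2 * A)) * z.2 ^ 5 + z.2 ^ 6 * w z.2) + (z.1 - σ z.2) ^ 2 * Q z := by
  obtain ⟨r₀, ρ, r, R, hr₀, hρ, hr, hR, he⟩ := h
  let G : ℝ × ℝ → ℝ := fun z => A * z.1 ^ 2 + T * z.2 ^ 2 + B * z.1 * z.2 ^ 2 +
      C * z.2 ^ 4 + E * z.1 * z.2 ^ 3 + F * z.2 ^ 5 +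
      (z.1 ^ 3 * r₀ z + z.1 ^ 2 * z.2 ^ 2 * ρ z + z.1 * z.2 ^ 4 * r z + z.2 ^ 6 * R z)
  have hG : ContDiff ℝ ∞ G := by fun_prop
  have hGjet : HasWeightedJet G 0 0 A T B C E F :=
    ⟨r₀, ρ, r, R, hr₀, hρ, hr, hR, Filter.Eventually.of_forall fun z => by simp only [G]; ring⟩
  obtain ⟨σ, hσ, hσ0, hcrit⟩ := exists_critical_curve hG hGjet.hasDiagonalJet hA
  obtain ⟨Q, hQ, hsplit⟩ := exists_splitting hG hσ hcrit
  -- The functions `k₁` and `k₃` collect the `s`-derivative of the remainder into multiples of `s²`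
  -- and `t⁴`; the multiple of `st²` is `2ρ`.
  let k₁ : ℝ × ℝ → ℝ := fun z => 3 * r₀ z + z.1 * fderiv ℝ r₀ z (1, 0) +
    z.2 ^ 2 * fderiv ℝ ρ z (1, 0)
  let k₃ : ℝ × ℝ → ℝ := fun z => r z + z.1 * fderiv ℝ r z (1, 0) + z.2 ^ 2 * fderiv ℝ R z (1, 0)
  have hfd : ∀ u : ℝ × ℝ → ℝ, ContDiff ℝ ∞ u → Continuous fun z => fderiv ℝ u z (1, 0) :=
    fun u hu => (hu.continuous_fderiv (by simp)).clm_apply continuous_const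
  have hk₁ : Continuous k₁ := by
    have := hfd _ hr₀; have := hfd _ hρ; have := hr₀.continuous
    fun_prop
  have hk₃ : Continuous k₃ := by
    have := hfd _ hr; have := hfd _ hR; have := hr.continuous
    fun_prop
  have hρc := hρ.continuous
  have hder : ∀ s t, fderiv ℝ G (s, t) (1, 0) = 2 * A * s + B * t ^ 2 + E * t ^ 3 +
      s ^ 2 * k₁ (s, t) + s * t ^ 2 * (2 * ρ (s, t)) + t ^ 4 * k₃ (s, t) := by
    intro s t
    have d1 := hasDerivAt_slice_fst hr₀ s t
    have d2 := hasDerivAt_slice_fst hρ s t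
    have d3 := hasDerivAt_slice_fst hr s t
    have d4 := hasDerivAt_slice_fst hR s t
    have x := hasDerivAt_id s
    have D : HasDerivAt (fun x => G (x, t)) _ s :=
      (((((((x.pow 2).const_mul A).add_const (T * t ^ 2)).add
        ((x.const_mul B).mul_const (t ^ 2))).add_const (C * t ^ 4)).add
        ((x.const_mul E).mul_const (t ^ 3))).add_const (F * t ^ 5)).add
      (((((x.pow 3).mul d1).add (((x.pow 2).mul_const (t ^ 2)).mul d2)).add
        ((x.mul_const (t ^ 4)).mul d3)).add (d4.const_mul (t ^ 6)))
    rw [(hasDerivAt_slice_fst hG s t).unique D]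
    simp only [k₁, k₃, id, Pi.pow_apply]
    push_cast
    ring
  -- Dividing the critical equation by `t` shows that `σ` has no linear term; dividing by `t²` then
  -- gives the quadratic coefficient `-B/(2A)`.
  obtain ⟨a, ha, ea⟩ := exists_eq_add_smul hσ
  simp only [hσ0, zero_add, smul_eq_mul] at ea
  have hac := ha.continuous
  have hσc := hσ.continuous
  have ha0 : a 0 = 0 := by
    have := eq_zero_of_eventually_punctured (u := fun t => 2 * A * a t + B * t + E * t ^ 2 +
      t * a t ^ 2 * k₁ (σ t, t) + a t * t ^ 2 * (2 * ρ (σ t, t)) + t ^ 3 * k₃ (σ t, t))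
      (by fun_prop) ?_
    · simpa [hA] using this
    · filter_upwards [hcrit.filter_mono nhdsWithin_le_nhds, self_mem_nhdsWithin] with t h1 h2
      rw [hder] at h1
      have h2' : t ≠ 0 := h2
      apply mul_left_cancel₀ h2'
      rw [mul_zero, ← h1]
      generalize k₁ (σ t, t) = K1
      generalize k₃ (σ t, t) = K3
      generalize ρ (σ t, t) = K2
      rw [ea t]
      ring
  obtain ⟨b, hb, eb⟩ := exists_eq_add_smul ha
  simp only [ha0, zero_add, smul_eq_mul] at eb
  have hbc := hb.continuous
  have eσ : ∀ t, σ t = t ^ 2 * b t := fun t => by rw [ea, eb]; ring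
  have hb0 : b 0 = -B / (2 * A) := by
    have := eq_zero_of_eventually_punctured (u := fun t => 2 * A * b t + B + E * t +
      t ^ 2 * b t ^ 2 * k₁ (σ t, t) + b t * t ^ 2 * (2 * ρ (σ t, t)) + t ^ 2 * k₃ (σ t, t))
      (by fun_prop) ?_
    · simp at this
      field_simp
      linarith
    · filter_upwards [hcrit.filter_mono nhdsWithin_le_nhds, self_mem_nhdsWithin] with t h1 h2
      rw [hder] at h1
      have h2' : t ^ 2 ≠ 0 := pow_ne_zero 2 h2
      apply mul_left_cancel₀ h2'
      rw [mul_zero, ← h1]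
      generalize k₁ (σ t, t) = K1
      generalize k₃ (σ t, t) = K3
      generalize ρ (σ t, t) = K2
      rw [eσ t]
      ring
  obtain ⟨d, hd, ed⟩ := exists_eq_add_smul hb
  simp only [hb0, smul_eq_mul] at ed
  -- Substitute `σ = t²(b₀ + t d)` with `b₀ = -B/(2A)`. The unknown `d` enters at order `t⁵` only
  -- through `(2A b₀ + B) d = 0`, so the coefficients of `t⁴` and `t⁵` depend on `b₀` alone and the
  -- rest goes into `w`.
  refine ⟨σ, fun t => A * d t ^ 2 + E * d t + b t ^ 3 * r₀ (σ t, t) + b t ^ 2 * ρ (σ t, t) +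
    b t * r (σ t, t) + R (σ t, t), Q, hσ, by fun_prop, hQ, hσ0, ?_, ?_⟩
  · have hsp := hsplit.self_of_nhds
    have hrc := hr₀.continuous
    have hQc := hQ.continuous
    have := eq_zero_of_eventually_punctured (u := fun s => A + s * r₀ (s, 0) - Q (s, 0))
      (by fun_prop) ?_
    · simp only [zero_mul, add_zero] at this
      have h0 : Q 0 = Q (0, 0) := rfl
      rw [h0]
      linarith
    · filter_upwards [self_mem_nhdsWithin] with s hs
      have h1 := hsp s
      have hs' : s ^ 2 ≠ 0 := pow_ne_zero 2 hs
      simp only [hσ0, G] at h1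
      apply mul_left_cancel₀ hs'
      norm_num at h1
      linear_combination h1
  · have hsnd : Filter.Tendsto (fun z : ℝ × ℝ => z.2) (𝓝 0) (𝓝 0) := continuous_snd.tendsto 0
    filter_upwards [he, hsnd hsplit] with z h1 h2
    have h2' := h2 z.1
    have h3 : g z = G z := by rw [h1]; simp only [G]; ring
    rw [h3]
    have h4 : G z = G (z.1, z.2) := rfl
    rw [h4, h2', add_left_inj]
    simp only [G]
    generalize r₀ (σ z.2, z.2) = K1
    generalize ρ (σ z.2, z.2) = K2
    generalize r (σ z.2, z.2) = K3
    generalize R (σ z.2, z.2) = K4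
    rw [eσ, ed]
    field_simp
    ring

end HasWeightedJet

/-! ### Recognition of the singularities of type `A₁`, `A₃` and `A₄` -/

theorem hasFDerivAt_mul_of_eq_zero {E : Type*} [NormedAddCommGroup E] [NormedSpace ℝ E]
    {a b : E → ℝ} {a' : E →L[ℝ] ℝ} {x : E} (ha : HasFDerivAt a a' x)
    (hb : DifferentiableAt ℝ b x) (h0 : a x = 0) :
    HasFDerivAt (fun z => a z * b z) (b x • a') x := by
  have := ha.mul hb.hasFDerivAt
  rw [h0, zero_smul, zero_add] at this
  exact this

/-- A germ in split form is right equivalent to its principal part. -/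
theorem rightEquiv_of_split {g Q : ℝ × ℝ → ℝ} {σ u : ℝ → ℝ} {m : ℕ} (hm : m ≠ 0)
    (hσ : ContDiff ℝ ∞ σ) (hu : ContDiff ℝ ∞ u) (hQ : ContDiff ℝ ∞ Q) (hσ0 : σ 0 = 0)
    (he : ∀ᶠ z in 𝓝 (0 : ℝ × ℝ), g z = z.2 ^ m * u z.2 + (z.1 - σ z.2) ^ 2 * Q z)
    {ζ η : ℝ} (hζ : ζ * ζ = 1) (hη : η * η = 1) (hQ0 : 0 < ζ * Q 0) (hu0 : 0 < η * u 0) :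
    RightEquiv g (fun z => ζ * z.1 ^ 2 + η * z.2 ^ m) := by
  have hQ' : ContDiff ℝ ∞ fun z => ζ * Q z := contDiff_const.mul hQ
  have hu' : ContDiff ℝ ∞ fun z : ℝ × ℝ => η * u z.2 := contDiff_const.mul (hu.comp contDiff_snd)
  have hQp : ∀ᶠ z in 𝓝 (0 : ℝ × ℝ), 0 < ζ * Q z :=
    hQ'.continuous.continuousAt.eventually_const_lt hQ0
  have hup : ∀ᶠ z in 𝓝 (0 : ℝ × ℝ), 0 < η * u z.2 :=
    hu'.continuous.continuousAt.eventually_const_lt hu0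
  -- The signs `ζ`, `η` make both units positive, so their square root and `m`-th root are smooth
  -- and can be absorbed into the new coordinates.
  let b₁ : ℝ × ℝ → ℝ := fun z => √(ζ * Q z)
  let b₂ : ℝ × ℝ → ℝ := fun z => (η * u z.2) ^ (m : ℝ)⁻¹
  have hb₁ : IsSmoothGermAt b₁ 0 := by
    filter_upwards [hQp] with z hz
    exact hQ'.contDiffAt.sqrt hz.ne'
  have hb₂ : IsSmoothGermAt b₂ 0 := by
    filter_upwards [hup] with z hz
    exact hu'.contDiffAt.rpow_const_of_ne hz.ne'
  have ha₁ : ContDiff ℝ ∞ fun z : ℝ × ℝ => z.1 - σ z.2 := by fun_prop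
  let φ : ℝ × ℝ → ℝ × ℝ := fun z => ((z.1 - σ z.2) * b₁ z, z.2 * b₂ z)
  have hφs : IsSmoothGermAt φ 0 := by
    filter_upwards [hb₁, hb₂] with z h1 h2
    exact (ha₁.contDiffAt.mul h1).prodMk (contDiff_snd.contDiffAt.mul h2)
  have hφ0 : φ 0 = 0 := by simp [φ, hσ0]
  have hp1 : 0 < b₁ 0 := Real.sqrt_pos.2 hQ0
  have hp2 : 0 < b₂ 0 := Real.rpow_pos_of_pos hu0 _
  have d1 : HasFDerivAt (fun z : ℝ × ℝ => z.1 - σ z.2)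
      (ContinuousLinearMap.fst ℝ ℝ ℝ - deriv σ 0 • ContinuousLinearMap.snd ℝ ℝ ℝ) 0 := by
    have h1 : HasDerivAt σ (deriv σ 0) ((0 : ℝ × ℝ).2) :=
      (hσ.differentiable (by simp) 0).hasDerivAt
    exact hasFDerivAt_fst.sub (h1.comp_hasFDerivAt (0 : ℝ × ℝ) hasFDerivAt_snd)
  have D1 := hasFDerivAt_mul_of_eq_zero d1 (hb₁.contDiffAt.differentiableAt (by simp))
    (by simp [hσ0])
  have D2 := hasFDerivAt_mul_of_eq_zero (hasFDerivAt_snd (𝕜 := ℝ) (p := (0 : ℝ × ℝ)))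
    (hb₂.contDiffAt.differentiableAt (by simp)) rfl
  refine ⟨φ, isDiffeoGerm_of_injective hφs hφ0 (D1.prodMk D2) ?_, ?_⟩
  · intro v hv
    simp only [ContinuousLinearMap.prod_apply, Prod.mk_eq_zero, smul_apply,
      sub_apply, ContinuousLinearMap.coe_fst', ContinuousLinearMap.coe_snd',
      smul_eq_mul, mul_eq_zero, hp1.ne', hp2.ne', false_or] at hv
    obtain ⟨h1, h2⟩ := hv
    rw [h2, mul_zero, sub_zero] at h1
    exact Prod.ext h1 h2
  · filter_upwards [he, hQp, hup] with z h1 h2 h3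
    have e1 : b₁ z ^ 2 = ζ * Q z := Real.sq_sqrt h2.le
    have e2 : b₂ z ^ m = η * u z.2 := Real.rpow_inv_natCast_pow h3.le hm
    simp only [φ, mul_pow, e1, e2]
    rw [h1]
    linear_combination (-(z.1 - σ z.2) ^ 2 * Q z) * hζ - z.2 ^ m * u z.2 * hη

/-- Needed for a saddle with `A < 0 < T`: splitting yields `-s² + t²`, which becomes `s² - t²` after
exchanging the coordinates. -/
theorem RightEquiv.swap {g : ℝ × ℝ → ℝ} {h : ℝ × ℝ → ℝ} (H : RightEquiv g h) :
    RightEquiv g (fun z => h z.swap) := by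
  obtain ⟨φ, ⟨hφ, h0, ψ, hψ, hψ0, h1, h2⟩, he⟩ := H
  have hsw : ContDiff ℝ ∞ (Prod.swap : ℝ × ℝ → ℝ × ℝ) := contDiff_snd.prodMk contDiff_fst
  have hsw0 : Filter.Tendsto (Prod.swap : ℝ × ℝ → ℝ × ℝ) (𝓝 0) (𝓝 0) :=
    continuous_swap.tendsto' _ _ rfl
  refine ⟨fun z => (φ z).swap, ⟨?_, ?_, fun z => ψ z.swap, ?_, ?_, ?_, ?_⟩, ?_⟩
  · exact IsSmoothGermAt.comp (g := Prod.swap) (isSmoothGermAt_of_contDiff hsw _) hφ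
  · change (φ 0).swap = 0
    rw [h0]; rfl
  · exact IsSmoothGermAt.comp (g := ψ) hψ (isSmoothGermAt_of_contDiff hsw 0)
  · exact hψ0
  · simpa using h1
  · filter_upwards [hsw0 h2] with z hz
    have hz' : φ (ψ z.swap) = z.swap := hz
    rw [hz', Prod.swap_swap]
  · simpa using he

/-- On the curve `s = σ(t)` the squared term has zero differential, so only the derivative of the
function of `t` remains, and that is `O(tᵐ)`. -/
theorem not_gradientBound_of_split {g Q : ℝ × ℝ → ℝ} {σ v : ℝ → ℝ} {j m : ℕ} (hjm : j < m)
    (hσ : ContDiff ℝ ∞ σ) (hv : ContDiff ℝ ∞ v) (hQ : ContDiff ℝ ∞ Q) (hσ0 : σ 0 = 0)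
    (he : ∀ᶠ z in 𝓝 (0 : ℝ × ℝ), g z = z.2 ^ (m + 1) * v z.2 + (z.1 - σ z.2) ^ 2 * Q z) :
    ¬ GradientBound j g := by
  have hc : Filter.Tendsto (fun t : ℝ => (σ t, t)) (𝓝 0) (𝓝 0) := by
    have hσc := hσ.continuous
    refine Continuous.tendsto' (by fun_prop) _ _ ?_
    rw [hσ0]; rfl
  refine not_gradientBound_of_curve hjm hc (fun t => le_max_right _ _) ?_
  have key : ∀ᶠ t in 𝓝 (0 : ℝ), fderiv ℝ g (σ t, t) =
      t ^ m • (((m + 1) * v t + t * deriv v t) • ContinuousLinearMap.snd ℝ ℝ ℝ) := by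
    filter_upwards [hc he.eventually_nhds] with t ht
    have ht' : g =ᶠ[𝓝 (σ t, t)]
        fun z => z.2 ^ (m + 1) * v z.2 + (z.1 - σ z.2) ^ 2 * Q z := ht
    have h1 : HasDerivAt (fun t => t ^ (m + 1) * v t)
        (t ^ m * ((m + 1) * v t + t * deriv v t)) ((σ t, t) : ℝ × ℝ).2 := by
      have := (hasDerivAt_pow (m + 1) t).mul (hv.differentiable (by simp) t).hasDerivAt
      refine this.congr_deriv ?_
      push_cast
      ring
    have h2 := h1.comp_hasFDerivAt ((σ t, t) : ℝ × ℝ)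
      (hasFDerivAt_snd (𝕜 := ℝ) (p := ((σ t, t) : ℝ × ℝ)))
    have ha : Differentiable ℝ fun z : ℝ × ℝ => z.1 - σ z.2 :=
      (by fun_prop : ContDiff ℝ ∞ fun z : ℝ × ℝ => z.1 - σ z.2).differentiable (by simp)
    have h3 : HasFDerivAt (𝕜 := ℝ) (fun z : ℝ × ℝ => (z.1 - σ z.2) * ((z.1 - σ z.2) * Q z)) 0 (σ t, t) := by
      have := hasFDerivAt_mul_of_eq_zero (ha (σ t, t)).hasFDerivAt
        (b := fun z => (z.1 - σ z.2) * Q z)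
        ((ha _).mul (hQ.differentiable (by simp) _)) (by simp)
      simpa using this
    have h4 := h2.add h3
    rw [ht'.fderiv_eq]
    have h5 : HasFDerivAt (fun z => z.2 ^ (m + 1) * v z.2 + (z.1 - σ z.2) ^ 2 * Q z) _ (σ t, t) :=
      h4.congr_of_eventuallyEq (Filter.Eventually.of_forall fun z => by
        simp only [Pi.add_apply, Function.comp]; ring)
    rw [h5.fderiv]
    ext <;> simp
  have hvc := hv.continuous
  have hvd := hv.continuous_deriv (by simp)
  have hcont : Continuous fun t : ℝ =>
      ((m + 1) * v t + t * deriv v t) • ContinuousLinearMap.snd ℝ ℝ ℝ := by fun_prop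
  have hb := (isBigO_refl (fun t : ℝ => t ^ m) (𝓝 0)).smul (hcont.continuousAt.isBigO_one ℝ)
  refine hb.congr' (key.mono fun t h => h.symm) (Filter.Eventually.of_forall fun t => ?_)
  simp

theorem hasAt_iff {k : ℕ} {g : ℝ × ℝ → ℝ} : HasAt k g ↔
    (∃ η : ℝ, (η = 1 ∨ η = -1) ∧ RightEquiv g (powerModel η (k + 1))) ∧
      (2 ≤ k → hessianKernel g = Submodule.span ℝ {((0 : ℝ), (1 : ℝ))}) := by
  have e1 : powerModel 1 (k + 1) = fun z => z.1 ^ 2 + z.2 ^ (k + 1) := by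
    funext z; simp [powerModel]
  have e2 : powerModel (-1) (k + 1) = fun z => z.1 ^ 2 - z.2 ^ (k + 1) := by
    funext z; simp [powerModel, sub_eq_add_neg]
  simp only [HasAt, or_and_right, exists_or, exists_eq_left, e1, e2]

theorem exists_sign {x : ℝ} (hx : x ≠ 0) : ∃ η : ℝ, (η = 1 ∨ η = -1) ∧ 0 < η * x := by
  rcases lt_or_gt_of_ne hx with h | h
  · exact ⟨-1, Or.inr rfl, by linarith⟩
  · exact ⟨1, Or.inl rfl, by linarith⟩

theorem mul_self_of_sign {η : ℝ} (h : η = 1 ∨ η = -1) : η * η = 1 := by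
  rcases h with rfl | rfl <;> norm_num

namespace HasWeightedJet

variable {g : ℝ × ℝ → ℝ} {G₀ G₁ A T B C E F : ℝ}

theorem gradientBound_of_rightEquiv (h : HasWeightedJet g G₀ G₁ A T B C E F) {k : ℕ}
    (hk : 1 ≤ k) {η : ℝ} (hη : η = 1 ∨ η = -1) (H : RightEquiv g (powerModel η (k + 1))) :
    GradientBound k g :=
  (gradientBound_powerModel hη hk).of_rightEquiv h.hasDiagonalJet.smooth H.symm

theorem rightEquiv_powerModel_of_pos {Q : ℝ × ℝ → ℝ} {σ u : ℝ → ℝ} {m : ℕ}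
    (hm : m ≠ 0) (hσ : ContDiff ℝ ∞ σ) (hu : ContDiff ℝ ∞ u) (hQ : ContDiff ℝ ∞ Q) (hσ0 : σ 0 = 0)
    (he : ∀ᶠ z in 𝓝 (0 : ℝ × ℝ), g z = z.2 ^ m * u z.2 + (z.1 - σ z.2) ^ 2 * Q z)
    (hQ0 : 0 < Q 0) (hu0 : u 0 ≠ 0) :
    ∃ η : ℝ, (η = 1 ∨ η = -1) ∧ RightEquiv g (powerModel η m) := by
  obtain ⟨η, hη, hη0⟩ := exists_sign hu0
  refine ⟨η, hη, ?_⟩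
  have := rightEquiv_of_split hm hσ hu hQ hσ0 he (ζ := 1) (by norm_num)
    (mul_self_of_sign hη) (by linarith) hη0
  have e : powerModel η m = fun z => 1 * z.1 ^ 2 + η * z.2 ^ m := by
    funext z; simp [powerModel]
  rwa [e]

/-- The last condition excludes only the negative definite case, since `s² ± t²` always has a
positive direction. Nondegeneracy is forced by the gradient inequality with exponent `1`. -/
theorem hasAt_one_iff (h : HasWeightedJet g G₀ G₁ A T B C E F) :
    HasAt 1 g ↔ G₀ = 0 ∧ G₁ = 0 ∧ A ≠ 0 ∧ T ≠ 0 ∧ (0 < A ∨ 0 < T) := by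
  rw [hasAt_iff]
  constructor
  · rintro ⟨⟨η, hη, H⟩, -⟩
    obtain ⟨rfl, rfl⟩ := h.hasDiagonalJet.critical_of_rightEquiv (by norm_num) H
    have hGB := h.gradientBound_of_rightEquiv le_rfl hη H
    refine ⟨rfl, rfl, ?_, ?_, h.hasDiagonalJet.pos_of_rightEquiv (by norm_num) H⟩
    · exact fun hA => h.hasDiagonalJet.not_gradientBound_one (Or.inl hA) hGB
    · exact fun hT => h.hasDiagonalJet.not_gradientBound_one (Or.inr hT) hGB
  · rintro ⟨rfl, rfl, hA, hT, hpos⟩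
    refine ⟨?_, by norm_num⟩
    obtain ⟨σ, w, Q, hσ, hw, hQ, hσ0, hQ0, he⟩ := h.exists_split hA
    set u : ℝ → ℝ := fun t => T + (C - B ^ 2 / (4 * A)) * t ^ 2 + (F - E * B / (2 * A)) * t ^ 3 +
      t ^ 4 * w t with hu
    have hus : ContDiff ℝ ∞ u := by fun_prop
    have hu0 : u 0 = T := by simp [hu]
    have he' : ∀ᶠ z in 𝓝 (0 : ℝ × ℝ), g z = z.2 ^ 2 * u z.2 + (z.1 - σ z.2) ^ 2 * Q z := by
      filter_upwards [he] with z hz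
      rw [hz]; simp only [hu]; ring
    rcases lt_or_gt_of_ne hA with hA' | hA'
    · have hT' : 0 < T := hpos.resolve_left hA'.not_gt
      have := (rightEquiv_of_split two_ne_zero hσ hus hQ hσ0 he' (ζ := -1) (η := 1) (by norm_num)
        (by norm_num) (by rw [hQ0]; linarith) (by rw [hu0]; linarith)).swap
      refine ⟨-1, Or.inr rfl, ?_⟩
      convert this using 1
      funext z
      simp [powerModel]
      ring
    · exact rightEquiv_powerModel_of_pos two_ne_zero hσ hus hQ hσ0 he' (by rw [hQ0]; exact hA')
        (by rw [hu0]; exact hT)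

/-- The consequences of being of type `A_k`, `k ≥ 2`, for the weighted jet. -/
theorem of_hasAt (h : HasWeightedJet g G₀ G₁ A T B C E F) {k : ℕ} (hk : 2 ≤ k) (H : HasAt k g) :
    G₀ = 0 ∧ G₁ = 0 ∧ 0 < A ∧ T = 0 ∧ GradientBound k g ∧ ∀ j < k, ¬ GradientBound j g := by
  rw [hasAt_iff] at H
  obtain ⟨⟨η, hη, H⟩, hker⟩ := H
  obtain ⟨rfl, rfl⟩ := h.hasDiagonalJet.critical_of_rightEquiv (by omega) H
  obtain ⟨-, rfl⟩ := h.hasDiagonalJet.hessianKernel_eq_iff.1 (hker hk)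
  have hpos := h.hasDiagonalJet.pos_of_rightEquiv (by omega) H
  exact ⟨rfl, rfl, hpos.resolve_right (lt_irrefl 0), rfl,
    h.gradientBound_of_rightEquiv (by omega) hη H,
    fun j hj hb => not_gradientBound_powerModel η hj (hb.of_rightEquiv (powerModel_smooth _ _) H)⟩

/-- Up to the factor `-1/(4A)`, the discriminant is the coefficient of `t⁴` after splitting. If it
vanishes, the gradient is `O(t⁴)` along the critical curve, against the exponent `3` of the model.
-/
theorem hasAt_three_iff (h : HasWeightedJet g G₀ G₁ A T B C E F) :
    HasAt 3 g ↔ G₀ = 0 ∧ G₁ = 0 ∧ 0 < A ∧ T = 0 ∧ B ^ 2 - 4 * A * C ≠ 0 := by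
  constructor
  · intro H
    obtain ⟨rfl, rfl, hA, rfl, hGB, -⟩ := h.of_hasAt (by norm_num) H
    refine ⟨rfl, rfl, hA, rfl, fun hdisc => ?_⟩
    obtain ⟨σ, w, Q, hσ, hw, hQ, hσ0, hQ0, he⟩ := h.exists_split hA.ne'
    have hc : C - B ^ 2 / (4 * A) = 0 := by field_simp; linarith
    refine not_gradientBound_of_split (m := 4) (v := fun t => (F - E * B / (2 * A)) + t * w t)
      (by norm_num) hσ (by fun_prop) hQ hσ0 ?_ hGB
    filter_upwards [he] with z hz
    rw [hz, hc]; ring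
  · rintro ⟨rfl, rfl, hA, rfl, hdisc⟩
    rw [hasAt_iff]
    refine ⟨?_, fun _ => h.hasDiagonalJet.hessianKernel_eq_iff.2 ⟨hA.ne', rfl⟩⟩
    obtain ⟨σ, w, Q, hσ, hw, hQ, hσ0, hQ0, he⟩ := h.exists_split hA.ne'
    refine rightEquiv_powerModel_of_pos (m := 4) (u := fun t => (C - B ^ 2 / (4 * A)) +
      (F - E * B / (2 * A)) * t + t ^ 2 * w t) (by norm_num) hσ (by fun_prop) hQ hσ0 ?_
      (by rw [hQ0]; exact hA) ?_
    · filter_upwards [he] with z hz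
      rw [hz]; ring
    · have hA' := hA.ne'
      intro hc
      apply hdisc
      norm_num at hc
      field_simp at hc
      linarith

/-- A nonzero discriminant would give type `A₃`, hence the gradient inequality with exponent `3`,
which type `A₄` excludes. Once it vanishes, the coefficient `F - EB/(2A)` of `t⁵` decides in the
same way. -/
theorem hasAt_four_iff (h : HasWeightedJet g G₀ G₁ A T B C E F) :
    HasAt 4 g ↔ G₀ = 0 ∧ G₁ = 0 ∧ 0 < A ∧ T = 0 ∧ B ^ 2 - 4 * A * C = 0 ∧
      2 * A * F - E * B ≠ 0 := by
  constructor
  · intro H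
    obtain ⟨rfl, rfl, hA, rfl, hGB, hnGB⟩ := h.of_hasAt (by norm_num) H
    have hdisc : B ^ 2 - 4 * A * C = 0 := by
      by_contra hdisc
      have H3 := h.hasAt_three_iff.2 ⟨rfl, rfl, hA, rfl, hdisc⟩
      exact hnGB 3 (by norm_num) (h.of_hasAt (by norm_num) H3).2.2.2.2.1
    refine ⟨rfl, rfl, hA, rfl, hdisc, fun hD => ?_⟩
    obtain ⟨σ, w, Q, hσ, hw, hQ, hσ0, hQ0, he⟩ := h.exists_split hA.ne'
    have hc : C - B ^ 2 / (4 * A) = 0 := by field_simp; linarith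
    have hc' : F - E * B / (2 * A) = 0 := by field_simp; linarith
    refine not_gradientBound_of_split (m := 5) (v := w) (by norm_num) hσ hw hQ hσ0 ?_ hGB
    filter_upwards [he] with z hz
    rw [hz, hc, hc']; ring
  · rintro ⟨rfl, rfl, hA, rfl, hdisc, hD⟩
    rw [hasAt_iff]
    refine ⟨?_, fun _ => h.hasDiagonalJet.hessianKernel_eq_iff.2 ⟨hA.ne', rfl⟩⟩
    obtain ⟨σ, w, Q, hσ, hw, hQ, hσ0, hQ0, he⟩ := h.exists_split hA.ne'
    have hc : C - B ^ 2 / (4 * A) = 0 := by field_simp; linarith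
    refine rightEquiv_powerModel_of_pos (m := 5) (u := fun t => (F - E * B / (2 * A)) + t * w t)
      (by norm_num) hσ (by fun_prop) hQ hσ0 ?_ (by rw [hQ0]; exact hA) ?_
    · filter_upwards [he] with z hz
      rw [hz, hc]; ring
    · have hA' := hA.ne'
      intro hc
      apply hD
      norm_num at hc
      field_simp at hc
      linarith

end HasWeightedJet

/-! ### Taylor expansions with smooth remainder -/

section Taylor

variable {E : Type*} [NormedAddCommGroup E] [NormedSpace ℝ E]

theorem hasDerivAt_smul_self_zero {u : ℝ → E} (hu : ContDiff ℝ ∞ u) :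
    HasDerivAt (fun t : ℝ => t • u t) (u 0) 0 := by
  have := (hasDerivAt_id (0 : ℝ)).smul (hu.differentiable (by simp) 0).hasDerivAt
  simp only [id, zero_smul, one_smul, zero_add] at this
  exact this

variable [FiniteDimensional ℝ E]

theorem exists_taylor_one {c : ℝ → E} (hc : ContDiff ℝ ∞ c) :
    ∃ R : ℝ → E, ContDiff ℝ ∞ R ∧ ∀ s, c s = c 0 + s • deriv c 0 + s ^ 2 • R s := by
  obtain ⟨R₁, h₁, e₁⟩ := exists_eq_add_smul hc
  obtain ⟨R₂, h₂, e₂⟩ := exists_eq_add_smul h₁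
  have hd : deriv c 0 = R₁ 0 := by
    have : c = fun s => c 0 + s • R₁ s := funext e₁
    rw [this]
    exact ((hasDerivAt_smul_self_zero h₁).const_add (c 0)).deriv
  refine ⟨R₂, h₂, fun s => ?_⟩
  rw [hd, e₁ s, e₂ s]
  module

theorem exists_taylor_two {c : ℝ → E} (hc : ContDiff ℝ ∞ c) :
    ∃ R : ℝ → E, ContDiff ℝ ∞ R ∧
      ∀ s, c s = c 0 + s • deriv c 0 + (s ^ 2 / 2) • deriv (deriv c) 0 + s ^ 3 • R s := by
  obtain ⟨R₁, h₁, e₁⟩ := exists_eq_add_smul hc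
  obtain ⟨R₂, h₂, e₂⟩ := exists_taylor_one h₁
  have h₁' : ContDiff ℝ ∞ (deriv R₁) := ((contDiff_infty_iff_deriv).1 h₁).2
  have hd : deriv c = fun s => R₁ s + s • deriv R₁ s := by
    have : c = fun s => c 0 + s • R₁ s := funext e₁
    funext s
    conv_lhs => rw [this]
    have := ((hasDerivAt_id s).smul (h₁.differentiable (by simp) s).hasDerivAt).const_add (c 0)
    refine this.deriv.trans ?_
    simp [add_comm]
  have hdd : deriv (deriv c) 0 = (2 : ℝ) • deriv R₁ 0 := by
    rw [hd, two_smul]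
    exact ((h₁.differentiable (by simp) 0).hasDerivAt.add (hasDerivAt_smul_self_zero h₁')).deriv
  refine ⟨R₂, h₂, fun s => ?_⟩
  rw [hdd, hd, e₁ s, e₂ s]
  simp only [zero_smul, add_zero]
  module

end Taylor

theorem iteratedDeriv_add_smul_self {R : ℝ → E3} (hR : ContDiff ℝ ∞ R) (a : E3) (k : ℕ) :
    iteratedDeriv (k + 1) (fun t : ℝ => a + t • R t) =
      fun t => t • iteratedDeriv (k + 1) R t + ((k : ℝ) + 1) • iteratedDeriv k R t := by
  have hd : ∀ n t, HasDerivAt (iteratedDeriv n R) (iteratedDeriv (n + 1) R t) t := by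
    intro n t
    rw [iteratedDeriv_succ]
    exact ((hR.differentiable_iteratedDeriv n (by exact_mod_cast WithTop.coe_lt_top _)) t).hasDerivAt
  induction k with
  | zero =>
    funext t
    rw [iteratedDeriv_succ, iteratedDeriv_zero]
    have := ((hasDerivAt_id t).smul (hd 0 t)).const_add a
    simp only [iteratedDeriv_zero] at this
    refine this.deriv.trans ?_
    simp
  | succ k ih =>
    funext t
    rw [iteratedDeriv_succ, ih]
    have := ((hasDerivAt_id t).smul (hd (k + 1) t)).add ((hd k t).const_smul ((k : ℝ) + 1))
    refine this.deriv.trans ?_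
    simp only [id]
    push_cast
    module

/-- Dividing by `t` shifts the transversal coefficients down by one. Both their smoothness in `s`
and the Taylor expansion in `t` follow by induction on this. -/
theorem exists_transCoeff_succ {F : ℝ × ℝ → E3} (hF : ContDiff ℝ ∞ F) :
    ∃ R : ℝ × ℝ → E3, ContDiff ℝ ∞ R ∧ (∀ z, F z = F (z.1, 0) + z.2 • R z) ∧
      ∀ k s, transCoeff F (k + 1) s = ((k : ℝ) + 1) • transCoeff R k s := by
  obtain ⟨R, hR, e⟩ := exists_eq_add_snd_smul hF
  refine ⟨R, hR, e, fun k s => ?_⟩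
  have : (fun t => F (s, t)) = fun t => F (s, 0) + t • R (s, t) := funext fun t => e (s, t)
  unfold transCoeff
  rw [this, iteratedDeriv_add_smul_self (R := fun t => R (s, t))
    (hR.comp (contDiff_const.prodMk contDiff_id))]
  simp

theorem contDiff_transCoeff (k : ℕ) {F : ℝ × ℝ → E3} (hF : ContDiff ℝ ∞ F) :
    ContDiff ℝ ∞ (transCoeff F k) := by
  induction k generalizing F with
  | zero =>
    have : transCoeff F 0 = fun s => F (s, 0) := by funext s; simp [transCoeff]
    rw [this]
    exact hF.comp (contDiff_id.prodMk contDiff_const)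
  | succ k ih =>
    obtain ⟨R, hR, -, h⟩ := exists_transCoeff_succ hF
    rw [funext (h k)]
    exact (ih hR).const_smul _

theorem exists_taylor_snd (n : ℕ) {F : ℝ × ℝ → E3} (hF : ContDiff ℝ ∞ F) :
    ∃ R : ℝ × ℝ → E3, ContDiff ℝ ∞ R ∧ ∀ z, F z = ∑ k ∈ Finset.range n,
      (z.2 ^ k / (Nat.factorial k : ℝ)) • transCoeff F k z.1 + z.2 ^ n • R z := by
  induction n generalizing F with
  | zero => exact ⟨F, hF, fun z => by simp⟩
  | succ n ih =>
    obtain ⟨R, hR, e, h⟩ := exists_transCoeff_succ hF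
    obtain ⟨R', hR', e'⟩ := ih hR
    refine ⟨R', hR', fun z => ?_⟩
    rw [Finset.sum_range_succ', e z, e' z, smul_add, Finset.smul_sum]
    have h0 : (z.2 ^ 0 / (Nat.factorial 0 : ℝ)) • transCoeff F 0 z.1 = F (z.1, 0) := by
      simp [transCoeff]
    have h1 : ∀ k, (z.2 ^ (k + 1) / (Nat.factorial (k + 1) : ℝ)) • transCoeff F (k + 1) z.1 =
        z.2 • (z.2 ^ k / (Nat.factorial k : ℝ)) • transCoeff R k z.1 := by
      intro k
      rw [h, smul_smul, smul_smul, Nat.factorial_succ]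
      congr 1
      have : (Nat.factorial k : ℝ) ≠ 0 := by exact_mod_cast Nat.factorial_ne_zero k
      push_cast
      field_simp
      ring
    simp only [h0, h1]
    rw [smul_smul, pow_succ']
    abel

theorem transCoeff_eventuallyEq {f F : ℝ × ℝ → E3} (h : f =ᶠ[𝓝 0] F) (k : ℕ) :
    transCoeff f k =ᶠ[𝓝 0] transCoeff F k := by
  have hx : Filter.Tendsto (fun s : ℝ => (s, (0 : ℝ))) (𝓝 0) (𝓝 0) :=
    Continuous.tendsto' (by fun_prop) _ _ rfl
  filter_upwards [hx h.eventually_nhds] with s hs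
  have hy : Filter.Tendsto (fun t : ℝ => (s, t)) (𝓝 0) (𝓝 (s, 0)) :=
    Continuous.tendsto' (by fun_prop) _ _ rfl
  have : (fun t => f (s, t)) =ᶠ[𝓝 0] fun t => F (s, t) := hy hs
  exact this.iteratedDeriv_eq k

/-- The weighted jet of a squared distance function. -/
theorem hasWeightedJet_distSq {f R : ℝ × ℝ → E3} {γ c₂ c₃ c₄ c₅ : ℝ → E3} (hγ : ContDiff ℝ ∞ γ)
    (h₂ : ContDiff ℝ ∞ c₂) (h₃ : ContDiff ℝ ∞ c₃) (h₄ : ContDiff ℝ ∞ c₄) (h₅ : ContDiff ℝ ∞ c₅)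
    (hR : ContDiff ℝ ∞ R) (hf : ∀ᶠ z in 𝓝 (0 : ℝ × ℝ), f z = γ z.1 + (z.2 ^ 2 / 2) • c₂ z.1 +
      (z.2 ^ 3 / 6) • c₃ z.1 + (z.2 ^ 4 / 24) • c₄ z.1 + (z.2 ^ 5 / 120) • c₅ z.1 + z.2 ^ 6 • R z)
    (hγ0 : γ 0 = 0) (hγ1 : inner ℝ (deriv γ 0) (deriv γ 0) = 1)
    (hγ2 : inner ℝ (deriv γ 0) (c₂ 0) = 0) (h22 : inner ℝ (c₂ 0) (c₂ 0) = 1) (h30 : c₃ 0 = 0)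
    (P : E3) (ε : ℝ) :
    HasWeightedJet (fun z => distSqUnfolding f z P ε) (inner ℝ P P - ε ^ 2)
      (-2 * inner ℝ P (deriv γ 0)) (1 - inner ℝ P (deriv (deriv γ) 0)) (-inner ℝ P (c₂ 0))
      (-inner ℝ P (deriv c₂ 0)) (1 / 4 - inner ℝ P (c₄ 0) / 12) (-inner ℝ P (deriv c₃ 0) / 3)
      (-inner ℝ P (c₅ 0) / 60) := by
  obtain ⟨Γ, hΓ, eΓ⟩ := exists_taylor_two hγ
  obtain ⟨γ₁, hγ₁, eγ₁⟩ := exists_eq_add_smul hγ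
  have hγ₁0 : γ₁ 0 = deriv γ 0 := by
    have : γ = fun s => γ 0 + s • γ₁ s := funext eγ₁
    rw [this]
    exact ((hasDerivAt_smul_self_zero hγ₁).const_add (γ 0)).deriv.symm
  simp only [hγ0, zero_add] at eΓ eγ₁
  obtain ⟨k₂, hk₂, e₂⟩ := exists_taylor_one h₂
  obtain ⟨k₃, hk₃, e₃⟩ := exists_taylor_one h₃
  obtain ⟨k₄, hk₄, e₄⟩ := exists_eq_add_smul h₄
  obtain ⟨k₅, hk₅, e₅⟩ := exists_eq_add_smul h₅
  simp only [h30, zero_add] at e₃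
  -- Write `f = s γ₁ + t² X` with `X = c₂/2 + t c₃/6 + t² Z`. Since `⟨γ₁, c₂⟩` and `⟨γ₁, c₃⟩` vanish
  -- at `s = 0`, the mixed term of `‖f‖²` has weight at least six, and `‖X(0, t)‖² = 1/4 + O(t²)`
  -- because `c₃(0) = 0`. So `‖f‖²` contributes only `s² + t⁴/4` up to weight five; the rest is
  -- linear in `P`.
  let Z : ℝ × ℝ → E3 := fun z =>
    (1 / 24 : ℝ) • c₄ z.1 + (z.2 / 120) • c₅ z.1 + z.2 ^ 2 • R z
  have hZ : ContDiff ℝ ∞ Z := by fun_prop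
  let X : ℝ × ℝ → E3 := fun z => (1 / 2 : ℝ) • c₂ z.1 + (z.2 / 6) • c₃ z.1 + z.2 ^ 2 • Z z
  have hX : ContDiff ℝ ∞ X := by fun_prop
  obtain ⟨a₁, ha₁, ea₁⟩ := exists_eq_add_smul (F := fun s => inner ℝ (γ₁ s) (γ₁ s))
    (hγ₁.inner ℝ hγ₁)
  obtain ⟨a₂, ha₂, ea₂⟩ := exists_eq_add_smul (F := fun s => inner ℝ (γ₁ s) (c₂ s))
    (hγ₁.inner ℝ h₂)
  obtain ⟨a₃, ha₃, ea₃⟩ := exists_eq_add_smul (F := fun s => inner ℝ (γ₁ s) (c₃ s))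
    (hγ₁.inner ℝ h₃)
  obtain ⟨a₄, ha₄, ea₄⟩ := exists_eq_add_fst_smul (F := fun z => inner ℝ (X z) (X z))
    (hX.inner ℝ hX)
  simp only [hγ₁0, hγ1, hγ2, h30, inner_zero_right, zero_add, smul_eq_mul] at ea₁ ea₂ ea₃ ea₄
  have eX0 : ∀ t, inner ℝ (X (0, t)) (X (0, t)) =
      1 / 4 + t ^ 2 * (inner ℝ (c₂ 0) (Z (0, t)) + t ^ 2 * inner ℝ (Z (0, t)) (Z (0, t))) := by
    intro t
    simp only [X, h30, smul_zero, add_zero, inner_add_left, inner_add_right, inner_smul_left,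
      inner_smul_right, h22, real_inner_comm (c₂ 0) (Z (0, t))]
    simp only [conj_trivial]
    ring
  have hP : ∀ {k : ℝ → E3}, ContDiff ℝ ∞ k → ContDiff ℝ ∞ fun z : ℝ × ℝ => inner ℝ P (k z.1) :=
    fun hk => contDiff_const.inner ℝ (hk.comp contDiff_fst)
  refine ⟨fun z => a₁ z.1 - 2 * inner ℝ P (Γ z.1),
    fun z => a₂ z.1 + z.2 / 3 * a₃ z.1 - inner ℝ P (k₂ z.1) - z.2 / 3 * inner ℝ P (k₃ z.1),
    fun z => 2 * inner ℝ (γ₁ z.1) (Z z) + a₄ z - inner ℝ P (k₄ z.1) / 12 -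
      z.2 / 60 * inner ℝ P (k₅ z.1),
    fun z => inner ℝ (c₂ 0) (Z (0, z.2)) + z.2 ^ 2 * inner ℝ (Z (0, z.2)) (Z (0, z.2)) -
      2 * inner ℝ P (R z), ?_, ?_, ?_, ?_, ?_⟩
  · have := hP hΓ
    fun_prop
  · have := hP hk₂
    have := hP hk₃
    fun_prop
  · have := hP hk₄
    have := hP hk₅
    have := (hγ₁.comp (contDiff_fst (E := ℝ) (F := ℝ))).inner ℝ hZ
    simp only [Function.comp] at this
    fun_prop
  · have hZ' : ContDiff ℝ ∞ fun z : ℝ × ℝ => Z (0, z.2) :=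
      hZ.comp (contDiff_const.prodMk contDiff_snd)
    have := (contDiff_const (c := c₂ 0)).inner ℝ hZ'
    have := hZ'.inner ℝ hZ'
    have := (contDiff_const (c := P)).inner ℝ hR
    fun_prop
  · filter_upwards [hf] with z hz
    obtain ⟨s, t⟩ := z
    simp only at hz ⊢
    have hfX : f (s, t) = s • γ₁ s + t ^ 2 • X (s, t) := by
      rw [hz, eγ₁ s]
      simp only [X, Z]
      module
    have hPf : inner ℝ P (f (s, t)) = s * inner ℝ P (deriv γ 0) +
        s ^ 2 / 2 * inner ℝ P (deriv (deriv γ) 0) + s ^ 3 * inner ℝ P (Γ s) +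
        t ^ 2 / 2 * (inner ℝ P (c₂ 0) + s * inner ℝ P (deriv c₂ 0) + s ^ 2 * inner ℝ P (k₂ s)) +
        t ^ 3 / 6 * (s * inner ℝ P (deriv c₃ 0) + s ^ 2 * inner ℝ P (k₃ s)) +
        t ^ 4 / 24 * (inner ℝ P (c₄ 0) + s * inner ℝ P (k₄ s)) +
        t ^ 5 / 120 * (inner ℝ P (c₅ 0) + s * inner ℝ P (k₅ s)) + t ^ 6 * inner ℝ P (R (s, t)) := by
      rw [hz, eΓ s, e₂ s, e₃ s, e₄ s, e₅ s]
      simp only [inner_add_right, inner_smul_right]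
    have hff : inner ℝ (f (s, t)) (f (s, t)) = s ^ 2 * inner ℝ (γ₁ s) (γ₁ s) +
        2 * s * t ^ 2 * inner ℝ (γ₁ s) (X (s, t)) + t ^ 4 * inner ℝ (X (s, t)) (X (s, t)) := by
      rw [hfX]
      simp only [inner_add_left, inner_add_right, inner_smul_left, inner_smul_right,
        real_inner_comm (γ₁ s) (X (s, t)), conj_trivial]
      ring
    have hγX : inner ℝ (γ₁ s) (X (s, t)) = 1 / 2 * (s * a₂ s) + t / 6 * (s * a₃ s) +
        t ^ 2 * inner ℝ (γ₁ s) (Z (s, t)) := by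
      rw [← ea₂, ← ea₃]
      simp only [X, inner_add_right, inner_smul_right]
    have hXX := ea₄ (s, t)
    simp only [eX0] at hXX
    have hn : distSqUnfolding f (s, t) P ε =
        inner ℝ P P - 2 * inner ℝ P (f (s, t)) + inner ℝ (f (s, t)) (f (s, t)) - ε ^ 2 := by
      simp only [distSqUnfolding]
      rw [norm_sub_sq_real, real_inner_self_eq_norm_sq, real_inner_self_eq_norm_sq]
    rw [hn, hPf, hff, hγX, hXX, ea₁]
    ring

/-! ### A defining function of the tangent plane along a cuspidal cross cap -/

theorem eq_zero_of_pow_mul_isBigO {u : ℝ → ℝ} (hu : Continuous u) (n : ℕ)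
    (h : (fun t => t ^ n * u t) =O[𝓝 0] fun t => t ^ (n + 1)) : u 0 = 0 := by
  obtain ⟨K, hK⟩ := h.bound
  have h1 : ∀ᶠ t in 𝓝[≠] (0 : ℝ), ‖u t‖ ≤ K * |t| := by
    filter_upwards [hK.filter_mono nhdsWithin_le_nhds, self_mem_nhdsWithin] with t h1 h2
    have h2' : 0 < |t| := abs_pos.2 h2
    rw [norm_mul, norm_pow, norm_pow, Real.norm_eq_abs t, pow_succ] at h1
    refine le_of_mul_le_mul_left ?_ (pow_pos h2' n)
    linarith
  have h2 : Filter.Tendsto (fun t : ℝ => K * |t|) (𝓝[≠] 0) (𝓝 0) := by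
    have : Continuous fun t : ℝ => K * |t| := by fun_prop
    exact (this.tendsto' 0 0 (by simp)).mono_left nhdsWithin_le_nhds
  exact tendsto_nhds_unique ((hu.tendsto 0).mono_left nhdsWithin_le_nhds)
    (squeeze_zero_norm' h1 h2)

theorem isBigO_sub_fderiv_sq {E : Type*} [NormedAddCommGroup E] [NormedSpace ℝ E]
    {χ : E → ℝ} (hχ : ContDiff ℝ ∞ χ) :
    (fun x => χ x - χ 0 - fderiv ℝ χ 0 x) =O[𝓝 0] fun x => ‖x‖ ^ 2 := by
  have hd : DifferentiableAt ℝ (fderiv ℝ χ) 0 :=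
    (hχ.fderiv_right (m := ∞) (by simp)).differentiable (by simp) 0
  obtain ⟨K, hK, hb⟩ := hd.isBigO_sub.exists_pos
  obtain ⟨r, hr, hball⟩ := Metric.eventually_nhds_iff_ball.1 hb.bound
  refine IsBigO.of_bound K ?_
  filter_upwards [Metric.ball_mem_nhds 0 hr] with x hx
  have hx' : ‖x‖ < r := by simpa using hx
  have := (convex_closedBall (0 : E) ‖x‖).norm_image_sub_le_of_norm_fderiv_le' (𝕜 := ℝ)
    (f := χ) (φ := fderiv ℝ χ 0) (C := K * ‖x‖) (x := 0) (y := x)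
    (fun y _ => hχ.differentiable (by simp) y) (fun y hy => ?_) (by simp) (by simp)
  · simp only [sub_zero] at this
    rw [norm_pow, norm_norm, sq, ← mul_assoc]
    exact this
  · have hy' : ‖y‖ ≤ ‖x‖ := by simpa using hy
    have h1 := hball y (by simpa using hy'.trans_lt hx')
    rw [sub_zero] at h1
    exact h1.trans (by gcongr)

theorem crossCapModel_third_isBigO (σ : ℝ) {φ : ℝ × ℝ → ℝ × ℝ} (hφ : IsDiffeoGerm φ) :
    (fun z => crossCapModel σ (φ z) 2) =O[𝓝 0] fun z : ℝ × ℝ => ‖z‖ ^ 4 := by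
  have h0 : φ =O[𝓝 0] fun z : ℝ × ℝ => ‖z‖ := by
    obtain ⟨K, -, h⟩ := hφ.exists_norm_le
    refine IsBigO.of_bound K ?_
    simpa using h
  have h1 : (fun z => (φ z).1) =O[𝓝 0] fun z : ℝ × ℝ => ‖z‖ :=
    (IsBigO.of_bound 1 (Filter.Eventually.of_forall fun z => by
      rw [one_mul]; exact norm_fst_le _)).trans h0
  have h2 : (fun z => (φ z).2) =O[𝓝 0] fun z : ℝ × ℝ => ‖z‖ :=
    (IsBigO.of_bound 1 (Filter.Eventually.of_forall fun z => by
      rw [one_mul]; exact norm_snd_le _)).trans h0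
  have hc : (fun z => (φ z).2) =O[𝓝 0] fun _ => (1 : ℝ) :=
    (hφ.1.contDiffAt.continuousAt.snd).isBigO_one ℝ
  have h3 : (fun z => (φ z).1 + σ * (φ z).2 ^ 2) =O[𝓝 0] fun z : ℝ × ℝ => ‖z‖ := by
    refine h1.add ?_
    have := (hc.mul h2).const_mul_left σ
    simpa [sq] using this
  have h4 := (h2.pow 3).mul h3
  refine h4.congr (fun z => ?_) (fun z => by ring)
  simp [crossCapModel]

/-- Take for `χ` the third coordinate of the inverse target diffeomorphism: composed with `f` it
becomes `v³(u + σv²)` in source coordinates, which has order four. -/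
theorem HasCuspidalCrossCap.exists_tangent_function {f : ℝ × ℝ → E3}
    (hcc : HasCuspidalCrossCap f) : ∃ χ : E3 → ℝ, ContDiff ℝ ∞ χ ∧ χ 0 = 0 ∧ fderiv ℝ χ 0 ≠ 0 ∧
      (fun z => χ (f z)) =O[𝓝 0] fun z => ‖z‖ ^ 4 := by
  have key : ∀ σ : ℝ, RightLeftEquiv f (crossCapModel σ) → ∃ χ : E3 → ℝ, ContDiff ℝ ∞ χ ∧
      χ 0 = 0 ∧ fderiv ℝ χ 0 ≠ 0 ∧ (fun z => χ (f z)) =O[𝓝 0] fun z => ‖z‖ ^ 4 := by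
    rintro σ ⟨φ, Ψ, hφ, hΨ, he⟩
    obtain ⟨Θ, hΘ, hΘ0, h1, h2⟩ := hΨ.2.2
    have hpr : ContDiff ℝ ∞ fun x : E3 => x 2 :=
      (EuclideanSpace.proj (𝕜 := ℝ) (2 : Fin 3)).contDiff
    have hs : IsSmoothGermAt (fun x => Θ x 2) 0 :=
      IsSmoothGermAt.comp (g := fun x : E3 => x 2) (isSmoothGermAt_of_contDiff hpr _) hΘ
    obtain ⟨χ, hχ, hχe⟩ := hs.exists_contDiff
    have hg : Filter.Tendsto (fun z => crossCapModel σ (φ z)) (𝓝 0) (𝓝 0) := by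
      have hc : Continuous (crossCapModel σ) := by
        unfold crossCapModel
        refine (PiLp.continuous_toLp 2 _).comp (continuous_pi fun i => ?_)
        fin_cases i <;> simp <;> fun_prop
      have h0 : crossCapModel σ 0 = 0 := by
        ext i; fin_cases i <;> simp [crossCapModel]
      exact (hc.tendsto' 0 0 h0).comp hφ.tendsto
    refine ⟨χ, hχ, ?_, ?_, ?_⟩
    · rw [← hχe.self_of_nhds]
      simp [hΘ0]
    · intro hzero
      have hcomp : (fun x => χ (Ψ x)) =ᶠ[𝓝 0] fun x : E3 => x 2 := by
        filter_upwards [h1, hΨ.tendsto hχe] with x a1 a2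
        have a2' : Θ (Ψ x) 2 = χ (Ψ x) := a2
        rw [← a2', a1]
      have hd : HasFDerivAt (fun x => χ (Ψ x)) (0 : E3 →L[ℝ] ℝ) 0 := by
        have d1 := (hΨ.1.contDiffAt.differentiableAt (by simp)).hasFDerivAt
        have d2 : HasFDerivAt χ (fderiv ℝ χ 0) (Ψ 0) := by
          rw [hΨ.2.1]; exact (hχ.differentiable (by simp) 0).hasFDerivAt
        have := d2.comp (0 : E3) d1
        rw [hzero, ContinuousLinearMap.zero_comp] at this
        exact this
      have hd' : HasFDerivAt (fun x : E3 => x 2) (EuclideanSpace.proj (𝕜 := ℝ) (2 : Fin 3)) 0 :=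
        (EuclideanSpace.proj (𝕜 := ℝ) (2 : Fin 3)).hasFDerivAt
      have := (hd.congr_of_eventuallyEq hcomp.symm).unique hd'
      have := DFunLike.congr_fun this (!₂[0, 0, 1] : E3)
      simp at this
    · refine (crossCapModel_third_isBigO σ hφ).congr' ?_ Filter.EventuallyEq.rfl
      have hfz : ∀ᶠ z in 𝓝 (0 : ℝ × ℝ), Θ (f z) = crossCapModel σ (φ z) := by
        filter_upwards [he, hg h1] with z a1 a2
        rw [a1]; exact a2
      have hf0 : Filter.Tendsto f (𝓝 0) (𝓝 0) := by
        have : Filter.Tendsto (fun z => Ψ (crossCapModel σ (φ z))) (𝓝 0) (𝓝 0) :=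
          hΨ.tendsto.comp hg
        exact this.congr' (he.mono fun z h => h.symm)
      filter_upwards [hfz, hf0 hχe] with z a1 a2
      have a2' : Θ (f z) 2 = χ (f z) := a2
      rw [← a2', a1]
  rcases hcc with h | h
  exacts [key _ h, key _ h]

/-- A covector that vanishes on the second order data of a cuspidal cross cap. -/
theorem HasCuspidalCrossCap.exists_covector {f R : ℝ × ℝ → E3} (hcc : HasCuspidalCrossCap f)
    {γ : ℝ → E3} (hγ : ContDiff ℝ ∞ γ) (hγ0 : γ 0 = 0) (hR : ContDiff ℝ ∞ R) {v₂ v₃ : E3}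
    (hs : ∀ᶠ s in 𝓝 (0 : ℝ), f (s, 0) = γ s)
    (ht : ∀ᶠ t in 𝓝 (0 : ℝ), f (0, t) = (t ^ 2 / 2) • v₂ + (t ^ 3 / 6) • v₃ + t ^ 4 • R (0, t)) :
    ∃ ℓ : E3 →L[ℝ] ℝ, ℓ ≠ 0 ∧ ℓ (deriv γ 0) = 0 ∧ ℓ v₂ = 0 ∧ ℓ v₃ = 0 := by
  obtain ⟨χ, hχ, hχ0, hℓ, hO⟩ := hcc.exists_tangent_function
  have hT := isBigO_sub_fderiv_sq hχ
  simp only [hχ0, sub_zero] at hT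
  -- Use `χ(f) = ℓ(f) + O(‖f‖²)`. On the `s`-axis the error is `O(s²)`, which kills `ℓ(γ'(0))`; on
  -- the `t`-axis `f = O(t²)`, so the error is `O(t⁴)` and the coefficients of both `t²` and `t³`
  -- are killed.
  set ℓ := fderiv ℝ χ 0
  refine ⟨ℓ, hℓ, ?_, ?_⟩
  · obtain ⟨γ₁, hγ₁, e₁⟩ := exists_eq_add_smul hγ
    have hd : deriv γ 0 = γ₁ 0 := by
      have : γ = fun s => γ 0 + s • γ₁ s := funext e₁
      rw [this]
      exact ((hasDerivAt_smul_self_zero hγ₁).const_add (γ 0)).deriv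
    simp only [hγ0, zero_add] at e₁
    rw [hd]
    have hγc := hγ₁.continuous
    refine eq_zero_of_pow_mul_isBigO (u := fun s => ℓ (γ₁ s)) (by fun_prop) 1 ?_
    have hx : Filter.Tendsto (fun s : ℝ => (s, (0 : ℝ))) (𝓝 0) (𝓝 0) :=
      Continuous.tendsto' (by fun_prop) _ _ rfl
    have hγt : Filter.Tendsto γ (𝓝 0) (𝓝 0) := hγ.continuous.tendsto' _ _ hγ0
    have hγO : γ =O[𝓝 0] fun s : ℝ => s := by
      have := (isBigO_refl (fun s : ℝ => s) (𝓝 0)).smul (hγc.continuousAt.isBigO_one ℝ)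
      refine this.congr (fun s => (e₁ s).symm) (fun s => by simp)
    have b1 : (fun s => χ (f (s, 0))) =O[𝓝 0] fun s : ℝ => s ^ 2 := by
      have := hO.comp_tendsto hx
      refine this.trans ?_
      refine IsBigO.of_bound 1 ?_
      filter_upwards [Metric.ball_mem_nhds (0 : ℝ) one_pos] with s hs
      have hs' : |s| ≤ 1 := by simpa using (mem_ball_zero_iff.1 hs).le
      simp only [Function.comp, Prod.norm_def, norm_zero, Real.norm_eq_abs, one_mul, abs_pow,
        abs_nonneg, sup_of_le_left, abs_abs]
      exact pow_le_pow_of_le_one (abs_nonneg s) hs' (by norm_num)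
    have b2 : (fun s => χ (γ s) - ℓ (γ s)) =O[𝓝 0] fun s : ℝ => s ^ 2 :=
      (hT.comp_tendsto hγt).trans (hγO.norm_left.pow 2)
    refine (b1.sub b2).congr' ?_ Filter.EventuallyEq.rfl
    filter_upwards [hs] with s hs
    rw [hs, e₁ s]
    simp
  · have hRc := hR.continuous
    have hx : Filter.Tendsto (fun t : ℝ => ((0 : ℝ), t)) (𝓝 0) (𝓝 0) :=
      Continuous.tendsto' (by fun_prop) _ _ rfl
    let X : ℝ → E3 := fun t => (1 / 2 : ℝ) • v₂ + (t / 6) • v₃ + t ^ 2 • R (0, t)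
    have hX : Continuous X := by fun_prop
    have hfX : ∀ᶠ t in 𝓝 (0 : ℝ), f (0, t) = t ^ 2 • X t := by
      filter_upwards [ht] with t ht
      rw [ht]; simp only [X]; module
    have hXO : (fun t : ℝ => t ^ 2 • X t) =O[𝓝 0] fun t : ℝ => t ^ 2 := by
      have := (isBigO_refl (fun t : ℝ => t ^ 2) (𝓝 0)).smul (hX.continuousAt.isBigO_one ℝ)
      exact this.congr_right (fun s => by simp)
    have hXt : Filter.Tendsto (fun t : ℝ => t ^ 2 • X t) (𝓝 0) (𝓝 0) :=
      Continuous.tendsto' (by fun_prop) _ _ (by simp)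
    have b1 : (fun t => χ (f (0, t))) =O[𝓝 0] fun t : ℝ => t ^ 4 := by
      have := hO.comp_tendsto hx
      refine this.congr_right fun t => ?_
      simp only [Function.comp, Prod.norm_def, norm_zero, Real.norm_eq_abs, abs_nonneg,
        sup_of_le_right]
      exact Even.pow_abs (by decide) t
    have b2 : (fun t => χ (t ^ 2 • X t) - ℓ (t ^ 2 • X t)) =O[𝓝 0] fun t : ℝ => t ^ 4 := by
      refine (hT.comp_tendsto hXt).trans ?_
      refine (hXO.norm_left.pow 2).congr_right fun t => by ring
    have b3 : (fun t => t ^ 2 * ℓ (X t)) =O[𝓝 0] fun t : ℝ => t ^ 4 := by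
      refine (b1.sub b2).congr' ?_ Filter.EventuallyEq.rfl
      filter_upwards [hfX] with t ht
      rw [ht]; simp
    have b4 : (fun t : ℝ => t ^ 4) =O[𝓝 0] fun t : ℝ => t ^ 3 := by
      have := (isBigO_refl (fun t : ℝ => t ^ 3) (𝓝 0)).mul
        ((continuous_id (X := ℝ)).continuousAt (x := 0) |>.isBigO_one ℝ)
      exact this.congr (fun t => by simp; ring) (fun t => by simp)
    have hv₂ : ℓ v₂ = 0 := by
      have := eq_zero_of_pow_mul_isBigO (u := fun t => ℓ (X t)) (by fun_prop) 2 (b3.trans b4)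
      simpa [X] using this
    refine ⟨hv₂, ?_⟩
    have := eq_zero_of_pow_mul_isBigO (u := fun t => ℓ v₃ / 6 + t * ℓ (R (0, t))) (by fun_prop) 3
      (b3.congr_left fun t => by simp [X, hv₂]; ring)
    simpa using this

/-! ### The Frenet frame of the singular curve -/

theorem IsSmoothGermAt.deriv {E : Type*} [NormedAddCommGroup E] [NormedSpace ℝ E] {c : ℝ → E}
    {x : ℝ} (hc : IsSmoothGermAt c x) : IsSmoothGermAt (deriv c) x := by
  filter_upwards [hc] with s hs
  have h1 : ContDiffAt ℝ ∞ (fun y => fderiv ℝ c y 1) s :=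
    (hs.fderiv_right (m := ∞) (by simp)).clm_apply contDiffAt_const
  exact h1

theorem inner_eq_sum_three (v w : E3) :
    inner ℝ v w = v 0 * w 0 + v 1 * w 1 + v 2 * w 2 := by
  simp [PiLp.inner_apply, Fin.sum_univ_three]
  ring

theorem inner_cross_self (v w : E3) :
    inner ℝ (cross v w) (cross v w) =
      inner ℝ v v * inner ℝ w w - inner ℝ v w ^ 2 := by
  simp only [inner_eq_sum_three]
  simp [cross, crossProduct]
  ring

theorem inner_cross_right (v w : E3) : inner ℝ (cross v w) w = 0 := by
  simp only [inner_eq_sum_three]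
  simp [cross, crossProduct]
  ring

theorem contDiffAt_cross {E : Type*} [NormedAddCommGroup E] [NormedSpace ℝ E] {v w : E → E3}
    {x : E} (hv : ContDiffAt ℝ ∞ v x) (hw : ContDiffAt ℝ ∞ w x) :
    ContDiffAt ℝ ∞ (fun z => cross (v z) (w z)) x := by
  rw [contDiffAt_piLp]
  have hv' := fun i => (contDiffAt_piLp (p := 2) (n := ∞)).1 hv i
  have hw' := fun i => (contDiffAt_piLp (p := 2) (n := ∞)).1 hw i
  intro i
  fin_cases i
  · simpa [cross, crossProduct] using ((hv' 1).mul (hw' 2)).sub ((hv' 2).mul (hw' 1))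
  · simpa [cross, crossProduct] using ((hv' 2).mul (hw' 0)).sub ((hv' 0).mul (hw' 2))
  · simpa [cross, crossProduct] using ((hv' 0).mul (hw' 1)).sub ((hv' 1).mul (hw' 0))

theorem inner_deriv_of_const {v w : ℝ → E3} {x a : ℝ} (hv : DifferentiableAt ℝ v x)
    (hw : DifferentiableAt ℝ w x) (h : ∀ᶠ s in 𝓝 x, inner ℝ (v s) (w s) = a) :
    inner ℝ (v x) (deriv w x) + inner ℝ (deriv v x) (w x) = 0 := by
  have h1 := hv.hasDerivAt.inner ℝ hw.hasDerivAt
  have h2 : HasDerivAt (fun s => inner ℝ (v s) (w s)) 0 x :=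
    (hasDerivAt_const x a).congr_of_eventuallyEq h
  exact h1.unique h2

namespace IsFukuiNormalForm

variable {f : ℝ × ℝ → E3} {θ : ℝ → ℝ}

theorem gam_smooth (hf : IsFukuiNormalForm f θ) : IsSmoothGermAt (gam f) 0 :=
  IsSmoothGermAt.comp (g := f) (f := fun s : ℝ => (s, (0 : ℝ))) hf.smooth
    (isSmoothGermAt_of_contDiff (contDiff_id.prodMk contDiff_const) 0)

theorem tangentVec_smooth (hf : IsFukuiNormalForm f θ) : IsSmoothGermAt (tangentVec f) 0 :=
  hf.gam_smooth.deriv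

theorem curvature_pos (hf : IsFukuiNormalForm f θ) : 0 < curvature f 0 :=
  lt_of_le_of_ne (norm_nonneg _) hf.curvature_ne_zero.symm

theorem eventually_deriv_tangentVec_ne_zero (hf : IsFukuiNormalForm f θ) :
    ∀ᶠ s in 𝓝 (0 : ℝ), deriv (tangentVec f) s ≠ 0 :=
  hf.tangentVec_smooth.deriv.contDiffAt.continuousAt.eventually_ne
    (norm_ne_zero_iff.1 hf.curvature_ne_zero)

theorem normalVec_smooth (hf : IsFukuiNormalForm f θ) : IsSmoothGermAt (normalVec f) 0 := by
  filter_upwards [hf.tangentVec_smooth.deriv, hf.eventually_deriv_tangentVec_ne_zero] with s h1 h2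
  exact ((h1.norm ℝ h2).inv (norm_ne_zero_iff.2 h2)).smul h1

theorem binormalVec_smooth (hf : IsFukuiNormalForm f θ) : IsSmoothGermAt (binormalVec f) 0 := by
  filter_upwards [hf.tangentVec_smooth, hf.normalVec_smooth] with s h1 h2
  exact contDiffAt_cross h1 h2

theorem inner_normalVec_self (hf : IsFukuiNormalForm f θ) :
    ∀ᶠ s in 𝓝 (0 : ℝ), inner ℝ (normalVec f s) (normalVec f s) = (1 : ℝ) := by
  filter_upwards [hf.eventually_deriv_tangentVec_ne_zero] with s h
  have h' : ‖deriv (tangentVec f) s‖ ≠ 0 := norm_ne_zero_iff.2 h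
  rw [real_inner_self_eq_norm_sq, normalVec, norm_smul, curvature, norm_inv, norm_norm,
    inv_mul_cancel₀ h', one_pow]

theorem inner_tangentVec_normalVec (hf : IsFukuiNormalForm f θ) :
    ∀ᶠ s in 𝓝 (0 : ℝ), inner ℝ (tangentVec f s) (normalVec f s) = (0 : ℝ) := by
  filter_upwards [hf.arc_length.eventually_nhds, hf.tangentVec_smooth] with s h1 h2
  have hd := h2.differentiableAt (by simp)
  have h3 := inner_deriv_of_const (a := 1) hd hd (h1.mono fun y hy => by
    rw [real_inner_self_eq_norm_sq, hy, one_pow])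
  rw [real_inner_comm, real_inner_comm (tangentVec f s)] at h3
  rw [normalVec, inner_smul_right]
  have : inner ℝ (tangentVec f s) (deriv (tangentVec f) s) = (0 : ℝ) := by
    rw [real_inner_comm]
    rw [real_inner_comm (deriv (tangentVec f) s) (tangentVec f s)] at h3
    linarith
  rw [this, mul_zero]

theorem inner_binormalVec_self (hf : IsFukuiNormalForm f θ) :
    ∀ᶠ s in 𝓝 (0 : ℝ), inner ℝ (binormalVec f s) (binormalVec f s) = (1 : ℝ) := by
  filter_upwards [hf.arc_length, hf.inner_normalVec_self, hf.inner_tangentVec_normalVec]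
    with s h1 h2 h3
  rw [binormalVec, inner_cross_self, h2, h3, real_inner_self_eq_norm_sq, h1]
  norm_num

theorem inner_binormalVec_normalVec (s : ℝ) :
    inner ℝ (binormalVec f s) (normalVec f s) = (0 : ℝ) := inner_cross_right _ _

theorem deriv_tangentVec_zero (hf : IsFukuiNormalForm f θ) :
    deriv (tangentVec f) 0 = curvature f 0 • !₂[0, 1, 0] := by
  rw [← hf.normal_zero, normalVec, smul_smul, mul_inv_cancel₀ hf.curvature_ne_zero, one_smul]

theorem frame3_zero (hf : IsFukuiNormalForm f θ) :
    frame3 f θ 0 = !₂[0, Real.sin (θ 0), Real.cos (θ 0)] := by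
  rw [frame3, hf.normal_zero, hf.binormal_zero]
  ext i; fin_cases i <;> simp

theorem transCoeff_two_zero (hf : IsFukuiNormalForm f θ) :
    transCoeff f 2 0 = !₂[0, Real.cos (θ 0), -Real.sin (θ 0)] := by
  rw [hf.angle.self_of_nhds, frame2, hf.normal_zero, hf.binormal_zero]
  ext i; fin_cases i <;> simp

theorem frame3_differentiableAt (hf : IsFukuiNormalForm f θ) :
    DifferentiableAt ℝ (frame3 f θ) 0 := by
  have hn := hf.normalVec_smooth.contDiffAt.differentiableAt (by simp)
  have hb := hf.binormalVec_smooth.contDiffAt.differentiableAt (by simp)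
  have hθ := hf.angle_smooth.contDiffAt.differentiableAt (by simp)
  exact (hθ.sin.smul hn).add (hθ.cos.smul hb)

/-- The rotation of the frame vector `f₂` along the singular curve. -/
theorem inner_frame3_deriv_transCoeff_two (hf : IsFukuiNormalForm f θ) :
    inner ℝ (frame3 f θ 0) (deriv (transCoeff f 2) 0) = torsion f 0 - deriv θ 0 := by
  have hn := hf.normalVec_smooth.contDiffAt.differentiableAt (by simp)
  have hb := hf.binormalVec_smooth.contDiffAt.differentiableAt (by simp)
  have hθ := hf.angle_smooth.contDiffAt.differentiableAt (by simp)
  have e1 := inner_deriv_of_const hn hn hf.inner_normalVec_self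
  have e2 := inner_deriv_of_const hb hb hf.inner_binormalVec_self
  have e3 := inner_deriv_of_const hb hn (Filter.Eventually.of_forall inner_binormalVec_normalVec)
  have e4 : inner ℝ (deriv (normalVec f) 0) (binormalVec f 0) = torsion f 0 := rfl
  have hd : HasDerivAt (frame2 f θ) _ 0 :=
    (hθ.hasDerivAt.cos.smul hn.hasDerivAt).sub (hθ.hasDerivAt.sin.smul hb.hasDerivAt)
  have h2 : deriv (transCoeff f 2) 0 = _ := (Filter.EventuallyEq.deriv_eq hf.angle).trans hd.deriv
  have n1 := hf.inner_normalVec_self.self_of_nhds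
  have n2 := hf.inner_binormalVec_self.self_of_nhds
  have n3 := inner_binormalVec_normalVec (f := f) 0
  have n4 := n3
  rw [real_inner_comm] at n4
  rw [real_inner_comm (normalVec f 0) (deriv (normalVec f) 0)] at e1
  rw [real_inner_comm (binormalVec f 0) (deriv (binormalVec f) 0)] at e2
  rw [real_inner_comm (binormalVec f 0) (deriv (normalVec f) 0)] at e4
  rw [real_inner_comm (normalVec f 0) (deriv (binormalVec f) 0)] at e3
  rw [h2, frame3]
  simp only [inner_add_left, inner_add_right, inner_sub_right, inner_smul_left, inner_smul_right,
    conj_trivial, n1, n2, n3, n4, e4]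
  rw [e4] at e3
  have e1' : inner ℝ (normalVec f 0) (deriv (normalVec f) 0) = (0 : ℝ) := by linarith
  have e2' : inner ℝ (binormalVec f 0) (deriv (binormalVec f) 0) = (0 : ℝ) := by linarith
  have e3' : inner ℝ (normalVec f 0) (deriv (binormalVec f) 0) = -torsion f 0 := by linarith
  rw [e1', e2', e3']
  linear_combination (torsion f 0 - deriv θ 0) * Real.sin_sq_add_cos_sq (θ 0)

/-! ### The transversal Taylor coefficients -/

theorem transCoeff_one (hf : IsFukuiNormalForm f θ) : ∀ᶠ s in 𝓝 (0 : ℝ), transCoeff f 1 s = 0 := by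
  have hx : Filter.Tendsto (fun s : ℝ => (s, (0 : ℝ))) (𝓝 0) (𝓝 0) :=
    Continuous.tendsto' (by fun_prop) _ _ rfl
  filter_upwards [hx hf.half_arc_length] with s hs
  have hs' : inner ℝ (deriv (fun t => f (s, t)) 0) (deriv (fun t => f (s, t)) 0) =
    (0 : ℝ) ^ 2 := hs
  rw [transCoeff, iteratedDeriv_one]
  rw [zero_pow two_ne_zero] at hs'
  exact inner_self_eq_zero.1 hs'

/-- The expansion of `f` in the transversal variable. -/
theorem exists_expansion (hf : IsFukuiNormalForm f θ) :
    ∃ (F R : ℝ × ℝ → E3), ContDiff ℝ ∞ F ∧ ContDiff ℝ ∞ R ∧ f =ᶠ[𝓝 0] F ∧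
      ∀ᶠ z in 𝓝 (0 : ℝ × ℝ), f z = gam F z.1 + (z.2 ^ 2 / 2) • transCoeff F 2 z.1 +
        (z.2 ^ 3 / 6) • transCoeff F 3 z.1 + (z.2 ^ 4 / 24) • transCoeff F 4 z.1 +
        (z.2 ^ 5 / 120) • transCoeff F 5 z.1 + z.2 ^ 6 • R z := by
  obtain ⟨F, hF, he⟩ := hf.smooth.exists_contDiff
  obtain ⟨R, hR, h⟩ := exists_taylor_snd 6 hF
  refine ⟨F, R, hF, hR, he, ?_⟩
  have hfst : Filter.Tendsto (fun z : ℝ × ℝ => z.1) (𝓝 0) (𝓝 0) := continuous_fst.tendsto 0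
  have h1 : ∀ᶠ s in 𝓝 (0 : ℝ), transCoeff F 1 s = 0 := by
    filter_upwards [hf.transCoeff_one, transCoeff_eventuallyEq he 1] with s a1 a2
    rw [← a2, a1]
  filter_upwards [he, hfst h1] with z a1 a2
  have a2' : transCoeff F 1 z.1 = 0 := a2
  have a3 : transCoeff F 0 z.1 = gam F z.1 := by simp [transCoeff, gam]
  rw [a1, h z]
  simp only [Finset.sum_range_succ, Finset.sum_range_zero, zero_add, a2', a3, smul_zero, add_zero,
    pow_zero, Nat.factorial]
  norm_num

/-- This is the `t³` coefficient of `⟨f_t, f_t⟩ = t²` at `s = 0`, where `f_t = t f₂ + (t²/2) f₃ +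
O(t³)`. -/
theorem inner_transCoeff_two_three (hf : IsFukuiNormalForm f θ) :
    inner ℝ (transCoeff f 2 0) (transCoeff f 3 0) = (0 : ℝ) := by
  obtain ⟨F, R, hF, hR, he, h⟩ := hf.exists_expansion
  have hF0 : gam F 0 = 0 := by
    have := he.self_of_nhds
    rw [hf.map_zero] at this
    exact this.symm
  have hx : Filter.Tendsto (fun t : ℝ => ((0 : ℝ), t)) (𝓝 0) (𝓝 0) :=
    Continuous.tendsto' (by fun_prop) _ _ rfl
  rw [(transCoeff_eventuallyEq he 3).self_of_nhds]
  have h2 := (transCoeff_eventuallyEq he 2).self_of_nhds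
  have h22 : inner ℝ (transCoeff f 2 0) (transCoeff f 2 0) = (1 : ℝ) := by
    rw [hf.transCoeff_two_zero, inner_eq_sum_three]
    simp
    linear_combination Real.sin_sq_add_cos_sq (θ 0)
  rw [h2] at h22 ⊢
  set v₂ := transCoeff F 2 0
  set v₃ := transCoeff F 3 0
  set v₄ := transCoeff F 4 0
  set v₅ := transCoeff F 5 0
  have hRs : ContDiff ℝ ∞ fun t : ℝ => R (0, t) := hR.comp (contDiff_const.prodMk contDiff_id)
  let W : ℝ → E3 := fun t => (1 / 6 : ℝ) • v₄ + (t / 24) • v₅ + (6 * t ^ 2) • R (0, t) +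
    t ^ 3 • deriv (fun t : ℝ => R (0, t)) t
  have hWc : Continuous W := by
    have := hRs.continuous
    have := hRs.continuous_deriv (by simp)
    fun_prop
  have key : ∀ᶠ t in 𝓝 (0 : ℝ), inner ℝ (t • v₂ + (t ^ 2 / 2) • v₃ + t ^ 3 • W t)
      (t • v₂ + (t ^ 2 / 2) • v₃ + t ^ 3 • W t) = t ^ 2 := by
    filter_upwards [hx hf.half_arc_length, (hx.eventually h).eventually_nhds]
      with t a1 a2
    have a1' : inner ℝ (deriv (fun t => f (0, t)) t) (deriv (fun t => f (0, t)) t) = t ^ 2 := a1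
    have a2' : (fun t => f (0, t)) =ᶠ[𝓝 t] fun t => gam F 0 + (t ^ 2 / 2) • v₂ + (t ^ 3 / 6) • v₃ +
      (t ^ 4 / 24) • v₄ + (t ^ 5 / 120) • v₅ + t ^ 6 • R (0, t) := a2
    have p : ∀ (n : ℕ) (c : ℝ) (v : E3),
        HasDerivAt (fun t : ℝ => (t ^ n / c) • v) ((n * t ^ (n - 1) / c) • v) t :=
      fun n c v => ((hasDerivAt_pow n t).div_const c).smul_const v
    have hd := ((((p 2 2 v₂).const_add (gam F 0)).add (p 3 6 v₃)).add (p 4 24 v₄)).add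
      (p 5 120 v₅) |>.add ((hasDerivAt_pow 6 t).smul
        (hRs.differentiable (by simp) t).hasDerivAt)
    have hd' := a2'.deriv_eq.trans hd.deriv
    have hW : t • v₂ + (t ^ 2 / 2) • v₃ + t ^ 3 • W t = deriv (fun t => f (0, t)) t := by
      rw [hd']
      simp only [W]
      push_cast
      norm_num
      module
    rw [hW, a1']
  have := eq_zero_of_eventually_punctured (u := fun t => inner ℝ v₂ v₃ +
      t * (2 * inner ℝ v₂ (W t) + inner ℝ v₃ v₃ / 4 + t * inner ℝ v₃ (W t) +
        t ^ 2 * inner ℝ (W t) (W t))) (by fun_prop) ?_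
  · simpa using this
  · filter_upwards [key.filter_mono nhdsWithin_le_nhds, self_mem_nhdsWithin] with t a1 a2
    have a2' : t ^ 3 ≠ 0 := pow_ne_zero 3 a2
    apply mul_left_cancel₀ a2'
    simp only [inner_add_left, inner_add_right, inner_smul_left, inner_smul_right, conj_trivial,
      real_inner_comm v₂ v₃, real_inner_comm v₂ (W t), real_inner_comm v₃ (W t), h22] at a1
    linear_combination a1

/-- The vector `f₃(0)` is orthogonal to `γ'(0)` and to `f₂(0)`. If it were nonzero, the three
vectors would form a basis on which the nonzero covector of `HasCuspidalCrossCap.exists_covector`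
vanishes. -/
theorem transCoeff_three_eq_zero (hf : IsFukuiNormalForm f θ) (hcc : HasCuspidalCrossCap f) :
    transCoeff f 3 0 = 0 := by
  obtain ⟨F, R, hF, hR, he, h⟩ := hf.exists_expansion
  have hF0 : gam F 0 = 0 := by
    have := he.self_of_nhds
    rw [hf.map_zero] at this
    exact this.symm
  have hγ : ContDiff ℝ ∞ (gam F) := hF.comp (contDiff_id.prodMk contDiff_const)
  have hx : Filter.Tendsto (fun s : ℝ => (s, (0 : ℝ))) (𝓝 0) (𝓝 0) :=
    Continuous.tendsto' (by fun_prop) _ _ rfl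
  have hy : Filter.Tendsto (fun t : ℝ => ((0 : ℝ), t)) (𝓝 0) (𝓝 0) :=
    Continuous.tendsto' (by fun_prop) _ _ rfl
  have hgam : gam f =ᶠ[𝓝 0] gam F := hx he
  have e2 := (transCoeff_eventuallyEq he 2).self_of_nhds
  have e3 := (transCoeff_eventuallyEq he 3).self_of_nhds
  obtain ⟨ℓ, hℓ, l1, l2, l3⟩ := hcc.exists_covector (γ := gam F) hγ hF0
    (R := fun z => (1 / 24 : ℝ) • transCoeff F 4 0 + (z.2 / 120) • transCoeff F 5 0 +
      z.2 ^ 2 • R z) (v₂ := transCoeff F 2 0) (v₃ := transCoeff F 3 0) (by fun_prop)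
    hgam (by
      filter_upwards [hy h] with t ht
      have ht' : f (0, t) = gam F 0 + (t ^ 2 / 2) • transCoeff F 2 0 +
        (t ^ 3 / 6) • transCoeff F 3 0 + (t ^ 4 / 24) • transCoeff F 4 0 +
        (t ^ 5 / 120) • transCoeff F 5 0 + t ^ 6 • R (0, t) := ht
      rw [ht', hF0]
      module)
  rw [← e2] at l2
  rw [← e3] at l3
  rw [← hgam.deriv_eq] at l1
  change ℓ (tangentVec f 0) = 0 at l1
  have o1 := (hf.orthogonal 3 (by norm_num)).self_of_nhds
  have o2 := hf.inner_transCoeff_two_three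
  rw [hf.tangent_zero] at l1 o1
  rw [hf.transCoeff_two_zero] at l2 o2
  set v := transCoeff f 3 0
  have hexp : ∀ x : E3, ℓ x = x 0 * ℓ !₂[1, 0, 0] + x 1 * ℓ !₂[0, 1, 0] + x 2 * ℓ !₂[0, 0, 1] := by
    intro x
    have : x = x 0 • (!₂[1, 0, 0] : E3) + x 1 • (!₂[0, 1, 0] : E3) + x 2 • (!₂[0, 0, 1] : E3) := by
      ext i; fin_cases i <;> simp
    conv_lhs => rw [this]
    simp only [map_add, map_smul, smul_eq_mul]
  rw [inner_eq_sum_three] at o1 o2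
  simp at o1 o2
  rw [hexp] at l2 l3
  simp only [l1, mul_zero, zero_add] at l2 l3
  simp at l2
  set a := ℓ !₂[0, 1, 0]
  set b := ℓ !₂[0, 0, 1]
  have hsc := Real.sin_sq_add_cos_sq (θ 0)
  set S := Real.sin (θ 0)
  set Co := Real.cos (θ 0)
  by_contra hv
  -- The component of `f₃(0)` along `sin θ n + cos θ b` is the only one not yet known to vanish; if
  -- it is nonzero, `ℓ` must vanish on that direction as well.
  have hk : v 1 * S + v 2 * Co ≠ 0 := by
    intro hk
    apply hv
    have c1 : v 1 = 0 := by linear_combination (-v 1) * hsc + Co * o2 + S * hk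
    have c2 : v 2 = 0 := by linear_combination (-v 2) * hsc - S * o2 + Co * hk
    ext i; fin_cases i
    · simpa using o1
    · simpa using c1
    · simpa using c2
  have hab : a * S + b * Co = 0 := by
    have : (v 1 * S + v 2 * Co) * (a * S + b * Co) = 0 := by
      linear_combination (S ^ 2 + Co ^ 2) * l3 - (a * Co - b * S) * o2
    exact (mul_eq_zero.1 this).resolve_left hk
  have ha : a = 0 := by linear_combination (-a) * hsc + Co * l2 + S * hab
  have hb : b = 0 := by linear_combination (-b) * hsc - S * l2 + Co * hab
  apply hℓ
  ext x
  rw [hexp, l1, ha, hb]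
  simp

/-! ### The weighted jet of the distance squared function -/

theorem hasWeightedJet (hf : IsFukuiNormalForm f θ) (hcc : HasCuspidalCrossCap f)
    (p q r ε : ℝ) : HasWeightedJet (fun z => distSqUnfolding f z !₂[p, q, r] ε)
      (p ^ 2 + q ^ 2 + r ^ 2 - ε ^ 2) (-2 * p) (1 - curvature f 0 * q)
      (-q * Real.cos (θ 0) + r * Real.sin (θ 0))
      (-inner ℝ !₂[p, q, r] (deriv (transCoeff f 2) 0))
      (1 / 4 - inner ℝ !₂[p, q, r] (transCoeff f 4 0) / 12)
      (-inner ℝ !₂[p, q, r] (deriv (transCoeff f 3) 0) / 3)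
      (-inner ℝ !₂[p, q, r] (transCoeff f 5 0) / 60) := by
  obtain ⟨F, R, hF, hR, he, h⟩ := hf.exists_expansion
  have hF0 : gam F 0 = 0 := by
    have := he.self_of_nhds
    rw [hf.map_zero] at this
    exact this.symm
  have hγ : ContDiff ℝ ∞ (gam F) := hF.comp (contDiff_id.prodMk contDiff_const)
  have hx : Filter.Tendsto (fun s : ℝ => (s, (0 : ℝ))) (𝓝 0) (𝓝 0) :=
    Continuous.tendsto' (by fun_prop) _ _ rfl
  have hgam : gam f =ᶠ[𝓝 0] gam F := hx he
  have t1 : deriv (gam F) 0 = !₂[1, 0, 0] := by rw [← hgam.deriv_eq]; exact hf.tangent_zero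
  have t2 : deriv (deriv (gam F)) 0 = curvature f 0 • !₂[0, 1, 0] := by
    rw [← hgam.deriv.deriv_eq]; exact hf.deriv_tangentVec_zero
  have c2 := transCoeff_eventuallyEq he 2
  have c3 := transCoeff_eventuallyEq he 3
  have v2 : transCoeff F 2 0 = _ := c2.self_of_nhds.symm.trans hf.transCoeff_two_zero
  have jet := hasWeightedJet_distSq hγ (contDiff_transCoeff 2 hF) (contDiff_transCoeff 3 hF)
    (contDiff_transCoeff 4 hF) (contDiff_transCoeff 5 hF) hR h hF0
    (by rw [t1, inner_eq_sum_three]; simp) (by rw [t1, v2, inner_eq_sum_three]; simp)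
    (by
      rw [v2, inner_eq_sum_three]
      simp
      linear_combination Real.sin_sq_add_cos_sq (θ 0))
    (c3.self_of_nhds.symm.trans (hf.transCoeff_three_eq_zero hcc)) !₂[p, q, r] ε
  rw [t1, t2, v2, ← c2.deriv_eq, ← c3.deriv_eq, ← (transCoeff_eventuallyEq he 4).self_of_nhds,
    ← (transCoeff_eventuallyEq he 5).self_of_nhds] at jet
  have i0 : inner ℝ (!₂[p, q, r] : E3) !₂[p, q, r] - ε ^ 2 = p ^ 2 + q ^ 2 + r ^ 2 - ε ^ 2 := by
    rw [inner_eq_sum_three]; simp; ring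
  have i1 : inner ℝ (!₂[p, q, r] : E3) !₂[1, 0, 0] = p := by
    rw [inner_eq_sum_three]; simp
  have i2 : inner ℝ (!₂[p, q, r] : E3) (curvature f 0 • !₂[0, 1, 0]) = curvature f 0 * q := by
    rw [inner_eq_sum_three]; simp; ring
  have i3 : -inner ℝ (!₂[p, q, r] : E3) !₂[0, Real.cos (θ 0), -Real.sin (θ 0)] =
      -q * Real.cos (θ 0) + r * Real.sin (θ 0) := by
    rw [inner_eq_sum_three]; simp; ring
  rwa [i0, i1, i2, i3] at jet

theorem bCoeff_zero_eq (k : ℕ) : bCoeff f θ 0 k = inner ℝ (frame3 f θ 0) (transCoeff f k 0) := by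
  simp [bCoeff, bFun, real_inner_comm]

/-- In the product rule the derivative of the moving frame is paired with `f₃(0) = 0` and drops out.
-/
theorem bCoeff_one_three_eq (hf : IsFukuiNormalForm f θ) (hcc : HasCuspidalCrossCap f) :
    bCoeff f θ 1 3 = inner ℝ (frame3 f θ 0) (deriv (transCoeff f 3) 0) := by
  obtain ⟨F, hF, he⟩ := hf.smooth.exists_contDiff
  have hd : DifferentiableAt ℝ (transCoeff f 3) 0 :=
    ((contDiff_transCoeff 3 hF).differentiable (by simp) 0).congr_of_eventuallyEq
      (transCoeff_eventuallyEq he 3)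
  have := (hd.hasDerivAt.inner ℝ hf.frame3_differentiableAt.hasDerivAt).deriv
  rw [hf.transCoeff_three_eq_zero hcc, inner_zero_left, zero_add, real_inner_comm] at this
  rw [bCoeff, iteratedDeriv_one]
  exact this

/-- On the focal line the centre of the sphere is a multiple of the frame vector `frame3`. -/
theorem centre_eq_smul_frame3 (hf : IsFukuiNormalForm f θ) {q r : ℝ} (hc : Real.cos (θ 0) ≠ 0)
    (h : -q * Real.cos (θ 0) + r * Real.sin (θ 0) = 0) :
    (!₂[0, q, r] : E3) = (r / Real.cos (θ 0)) • frame3 f θ 0 := by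
  rw [hf.frame3_zero]
  ext i
  fin_cases i
  · simp
  · simp
    field_simp
    linarith
  · simp
    field_simp

end IsFukuiNormalForm

end CuspidalCrossCap

end

/-! ### The recognition criteria in terms of centre and radius -/

theorem mainTheorem4
    (f : ℝ × ℝ → CuspidalCrossCap.E3) (θ : ℝ → ℝ)
    (hf : CuspidalCrossCap.IsFukuiNormalForm f θ)
    (hcc : CuspidalCrossCap.HasCuspidalCrossCap f)
    (p q r ε : ℝ) :
    let Φ : ℝ × ℝ → ℝ := fun z => CuspidalCrossCap.distSqUnfolding f z !₂[p, q, r] ε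
    let κ₀ : ℝ := CuspidalCrossCap.curvature f 0
    let τ₀ : ℝ := CuspidalCrossCap.torsion f 0
    let θ₀ : ℝ := θ 0
    let θ₁ : ℝ := deriv θ 0
    let b₁₃ : ℝ := CuspidalCrossCap.bCoeff f θ 1 3
    let b₀₅ : ℝ := CuspidalCrossCap.bCoeff f θ 0 5
    -- the origin is a critical point of `Φ` with critical value `0`
    let crit : Prop := p = 0 ∧ ε ^ 2 = p ^ 2 + q ^ 2 + r ^ 2
    let condA₁ : Prop := crit ∧ q ≠ 1 / κ₀ ∧ -q * Real.cos θ₀ + r * Real.sin θ₀ ≠ 0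
    let condA₃ : Prop := crit ∧ q ≠ 1 / κ₀ ∧ -q * Real.cos θ₀ + r * Real.sin θ₀ = 0 ∧
      CuspidalCrossCap.C2 f θ (r / Real.cos θ₀) ≠ 0
    let condA₄ : Prop := crit ∧ q ≠ 1 / κ₀ ∧ -q * Real.cos θ₀ + r * Real.sin θ₀ = 0 ∧
      CuspidalCrossCap.C2 f θ (r / Real.cos θ₀) = 0 ∧
      (b₁₃ * (τ₀ - θ₁) - b₀₅ / 10 * κ₀ * Real.sin θ₀) * (r / Real.cos θ₀) + b₀₅ / 10 ≠ 0
    -- (i)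
    ((CuspidalCrossCap.HasAt 1 Φ ∨ CuspidalCrossCap.HasAt 1 (-Φ)) ↔ condA₁) ∧
    (CuspidalCrossCap.HasAt 1 Φ ↔
      condA₁ ∧ (q < 1 / κ₀ ∨ 0 < -q * Real.cos θ₀ + r * Real.sin θ₀)) ∧
    (Real.cos θ₀ ≠ 0 →
      -- (ii)
      ((CuspidalCrossCap.HasAt 3 Φ ∨ CuspidalCrossCap.HasAt 3 (-Φ)) ↔ condA₃) ∧
      (CuspidalCrossCap.HasAt 3 Φ ↔ condA₃ ∧ q < 1 / κ₀) ∧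
      -- (iii)
      ((CuspidalCrossCap.HasAt 4 Φ ∨ CuspidalCrossCap.HasAt 4 (-Φ)) ↔ condA₄) ∧
      (CuspidalCrossCap.HasAt 4 Φ ↔ condA₄ ∧ q < 1 / κ₀)) := by
  intro Φ κ₀ τ₀ θ₀ θ₁ b₁₃ b₀₅ crit condA₁ condA₃ condA₄
  have jet := hf.hasWeightedJet hcc p q r ε
  -- The criteria for `A₃` and `A₄` demand a positive coefficient of `s²`: for `Φ` this means `q <
  -- 1/κ₀`, for `-Φ` it means `q > 1/κ₀`. Both `B² - 4AC` and `2AF - EB` are quadratic in the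
  -- coefficients, so negation leaves them unchanged.
  have jetneg := jet.neg
  have hκ : 0 < κ₀ := hf.curvature_pos
  have hA : 0 < 1 - κ₀ * q ↔ q < 1 / κ₀ := by
    rw [lt_div_iff₀ hκ, sub_pos, mul_comm]
  have hA' : 0 < -(1 - κ₀ * q) ↔ 1 / κ₀ < q := by
    rw [div_lt_iff₀ hκ, neg_pos, sub_neg, mul_comm]
  have hA0 : 1 - κ₀ * q ≠ 0 ↔ q ≠ 1 / κ₀ := by
    rw [not_iff_not, eq_div_iff hκ.ne', sub_eq_zero, mul_comm, eq_comm]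
  have hcrit : p ^ 2 + q ^ 2 + r ^ 2 - ε ^ 2 = 0 ∧ -2 * p = 0 ↔ crit := by
    simp only [crit]
    constructor
    · rintro ⟨h1, h2⟩
      exact ⟨by linarith, by linarith⟩
    · rintro ⟨h1, h2⟩
      exact ⟨by linarith, by linarith⟩
  have hcritneg : -(p ^ 2 + q ^ 2 + r ^ 2 - ε ^ 2) = 0 ∧ -(-2 * p) = 0 ↔ crit := by
    rw [neg_eq_zero, neg_eq_zero, hcrit]
  set T : ℝ := -q * Real.cos θ₀ + r * Real.sin θ₀ with hT
  have one := jet.hasAt_one_iff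
  have oneneg := jetneg.hasAt_one_iff
  rw [← and_assoc, hcrit, hA0, hA] at one
  rw [← and_assoc, hcritneg, hA', neg_ne_zero, neg_ne_zero, hA0, neg_pos] at oneneg
  refine ⟨?_, ?_, fun hcos => ?_⟩
  · rw [one, oneneg]
    constructor
    · rintro (⟨h1, h2, h3, -⟩ | ⟨h1, h2, h3, -⟩) <;> exact ⟨h1, h2, h3⟩
    · rintro ⟨h1, h2, h3⟩
      rcases lt_or_gt_of_ne h2 with h | h
      · exact Or.inl ⟨h1, h2, h3, Or.inl h⟩
      · exact Or.inr ⟨h1, h2, h3, Or.inl h⟩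
  · rw [one]
    simp only [condA₁, and_assoc, hT]
  -- The discriminant and the quintic coefficient on the focal line.
  have focal : crit → T = 0 →
      (-inner ℝ !₂[p, q, r] (deriv (CuspidalCrossCap.transCoeff f 2) 0)) ^ 2 -
        4 * (1 - κ₀ * q) * (1 / 4 - inner ℝ !₂[p, q, r] (CuspidalCrossCap.transCoeff f 4 0) / 12) =
        CuspidalCrossCap.C2 f θ (r / Real.cos θ₀) ∧
      2 * (1 - κ₀ * q) * (-inner ℝ !₂[p, q, r] (CuspidalCrossCap.transCoeff f 5 0) / 60) -
        -inner ℝ !₂[p, q, r] (deriv (CuspidalCrossCap.transCoeff f 3) 0) / 3 *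
          -inner ℝ !₂[p, q, r] (deriv (CuspidalCrossCap.transCoeff f 2) 0) =
        -(r / Real.cos θ₀) / 3 * ((b₁₃ * (τ₀ - θ₁) - b₀₅ / 10 * κ₀ * Real.sin θ₀) *
          (r / Real.cos θ₀) + b₀₅ / 10) := by
    rintro ⟨rfl, -⟩ hT0
    have hq : q = r / Real.cos θ₀ * Real.sin θ₀ := by
      field_simp
      linarith
    rw [hf.centre_eq_smul_frame3 hcos hT0]
    simp only [real_inner_smul_left, hf.inner_frame3_deriv_transCoeff_two,
      ← CuspidalCrossCap.IsFukuiNormalForm.bCoeff_zero_eq, ← hf.bCoeff_one_three_eq hcc,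
      CuspidalCrossCap.C2]
    rw [show θ 0 = θ₀ from rfl, show deriv θ 0 = θ₁ from rfl,
      show CuspidalCrossCap.torsion f 0 = τ₀ from rfl,
      show CuspidalCrossCap.curvature f 0 = κ₀ from rfl,
      show CuspidalCrossCap.bCoeff f θ 1 3 = b₁₃ from rfl,
      show CuspidalCrossCap.bCoeff f θ 0 5 = b₀₅ from rfl]
    generalize r / Real.cos θ₀ = e at hq ⊢
    rw [hq]
    constructor <;> ring
  -- Since `C₂(0) = -1`, a root of `C₂` is nonzero. This is why the factor `e` of the quintic
  -- coefficient can be omitted from the condition for `A₄`.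
  have hne : CuspidalCrossCap.C2 f θ (r / Real.cos θ₀) = 0 → r / Real.cos θ₀ ≠ 0 := by
    intro h h0
    rw [h0] at h
    simp [CuspidalCrossCap.C2] at h
  have three := jet.hasAt_three_iff
  have threeneg := jetneg.hasAt_three_iff
  have four := jet.hasAt_four_iff
  have fourneg := jetneg.hasAt_four_iff
  rw [← and_assoc, hcrit, hA] at three four
  rw [← and_assoc, hcritneg, hA', neg_eq_zero] at threeneg fourneg
  have three' : CuspidalCrossCap.HasAt 3 Φ ↔ condA₃ ∧ q < 1 / κ₀ := by
    rw [three]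
    constructor
    · rintro ⟨h1, h2, h3, h4⟩
      exact ⟨⟨h1, h2.ne, h3, by rwa [← (focal h1 h3).1]⟩, h2⟩
    · rintro ⟨⟨h1, -, h3, h4⟩, h2⟩
      exact ⟨h1, h2, h3, by rwa [(focal h1 h3).1]⟩
  have threeneg' : CuspidalCrossCap.HasAt 3 (-Φ) ↔ condA₃ ∧ 1 / κ₀ < q := by
    rw [threeneg]
    constructor
    · rintro ⟨h1, h2, h3, h4⟩
      refine ⟨⟨h1, h2.ne', h3, ?_⟩, h2⟩
      rw [← (focal h1 h3).1]
      intro h; apply h4; linear_combination h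
    · rintro ⟨⟨h1, -, h3, h4⟩, h2⟩
      refine ⟨h1, h2, h3, ?_⟩
      rw [← (focal h1 h3).1] at h4
      intro h; apply h4; linear_combination h
  have four' : CuspidalCrossCap.HasAt 4 Φ ↔ condA₄ ∧ q < 1 / κ₀ := by
    rw [four]
    constructor
    · rintro ⟨h1, h2, h3, h4, h5⟩
      rw [(focal h1 h3).1] at h4
      rw [(focal h1 h3).2] at h5
      exact ⟨⟨h1, h2.ne, h3, h4, right_ne_zero_of_mul h5⟩, h2⟩
    · rintro ⟨⟨h1, -, h3, h4, h5⟩, h2⟩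
      refine ⟨h1, h2, h3, by rwa [(focal h1 h3).1], ?_⟩
      rw [(focal h1 h3).2]
      exact mul_ne_zero (div_ne_zero (neg_ne_zero.2 (hne h4)) (by norm_num)) h5
  have fourneg' : CuspidalCrossCap.HasAt 4 (-Φ) ↔ condA₄ ∧ 1 / κ₀ < q := by
    rw [fourneg]
    constructor
    · rintro ⟨h1, h2, h3, h4, h5⟩
      refine ⟨⟨h1, h2.ne', h3, ?_, ?_⟩, h2⟩
      · rw [← (focal h1 h3).1]; linear_combination h4
      · refine right_ne_zero_of_mul (a := -(r / Real.cos θ₀) / 3) ?_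
        rw [← (focal h1 h3).2]
        intro h; apply h5; linear_combination h
    · rintro ⟨⟨h1, -, h3, h4, h5⟩, h2⟩
      have h6 := mul_ne_zero
        (div_ne_zero (neg_ne_zero.2 (hne h4)) (three_ne_zero (α := ℝ))) h5
      rw [← (focal h1 h3).2] at h6
      rw [← (focal h1 h3).1] at h4
      refine ⟨h1, h2, h3, by linear_combination h4, ?_⟩
      intro h; apply h6; linear_combination h
  refine ⟨?_, three', ?_, four'⟩
  · rw [three', threeneg', ← and_or_left, and_iff_left_iff_imp]
    exact fun h => lt_or_gt_of_ne h.2.1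
  · rw [four', fourneg', ← and_or_left, and_iff_left_iff_imp]
    exact fun h => lt_or_gt_of_ne h.2.1
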